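/- For $\varepsilon>0$ and $a,b,c,d\in\mathbb R$ consider the coupled wave–heat system $$ \begin{cases} u_{tt}=u_{xx},\quad \varepsilon p_t=p_{xx}, & (x,t)\in(0,1)\times(0,\infty),\\ u(0,t)=0,\quad u_x(1,t)=-a\,u_t(1,t)+b\,p(0,t), & t>0,\\ p_x(0,t)=c\,p(0,t),\quad p_x(1,t)=d\,u(1,t), & t>0,\\ u(\cdot,0)=u_0,\quad u_t(\cdot,0)=u_1,\quad p(\cdot,0)=p_0. & \end{cases}\tag{S} $$ Let $A_\varepsilon(u,v,p)=(v,u_{xx},\varepsilon^{-1}p_{xx})$ on the set of all $(u,v,p)\in H^2(0,1)\times H^1(0,1)\times H^2(0,1)$ with $u(0)=v(0)=0$, $u_x(1)=-av(1)+bp(0)$, $p_x(0)=cp(0)$, $p_x(1)=du(1)$. A (mild) solution of (S) is a function $Y=(u,u_t,p)\in C([0,\infty);H^1(0,1)\times L^2(0,1)\times L^2(0,1))$ such that for every $t\ge 0$ the integral $\int_0^tY(s)\,ds$ lies in the domain of $A_\varepsilon$ and $Y(t)=(u_0,u_1,p_0)+A_\varepsilon\int_0^tY(s)\,ds$. Let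 $\eta=\frac{\sqrt3+1}{\sqrt3-1}$, $\mu^*=\ln\frac{|1+a|}{\sqrt2\,|1-a|}$, $F(\mu)=2\sinh\mu+10\cosh\mu$, and suppose that $a,b,c,d\in\mathbb R$ and $0<\mu\le\mu^*$ satisfy (i) $a\in[\eta^{-1},\eta]\setminus\{1\}$; (ii) $\left|\frac{bd}{c}\right|\le 1$; (iii) $c\ge\frac{\pi^2}{8}$; (iv) $1+2(\sinh\mu+2\cosh\mu)b^2\le c$; (v) $|d|\le 2\sqrt{\mu e^{-\mu}}$, and moreover $\frac{|bd|}{c}\le\sqrt{\mu e^{-\mu}F(\mu)^{-1}}$. (1) If $\frac{\pi^2}{4}+F(\mu)b^2\le c$, then there are $\varepsilon_1^*,C_1>0$ such that for every $\varepsilon\in(0,\varepsilon_1^*)$ and all $(u_0,u_1,p_0)\in H^1(0,1)\times L^2(0,1)\times L^2(0,1)$ with $u_0(0)=0$, the system (S) has a unique solution, and it satisfies $$\|(u(t),u_t(t),p(t))\|_{H^1\times L^2\times L^2}\le C_1e^{-\frac{\mu}{4}t}\|(u_0,u_1,p_0)\|_{H^1\times L^2\times L^2}\qquad\text{for all }t\ge0.$$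 (2) If $3F(\mu)b^2\le c$, then there are $\varepsilon_2^*,C_2>0$ such that for every $\varepsilon\in(0,\varepsilon_2^*)$ and all $(u_0,u_1,p_0)\in H^1(0,1)\times L^2(0,1)\times H^1(0,1)$ with $u_0(0)=0$, the system (S) has a unique solution, and for all $t\ge0$ it satisfies $p(t)\in H^1(0,1)$ and $$\|(u(t),u_t(t),p(t))\|_{H^1\times L^2\times H^1}\le C_2e^{-\frac{\mu}{4}t}\|(u_0,u_1,p_0)\|_{H^1\times L^2\times H^1}.$$ -/

import Mathlib

open MeasureTheory Set
open scoped ContDiff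

noncomputable section

namespace WaveHeat

/-- Real `L²(0,1)`. -/
abbrev L2 : Type := Lp ℝ 2 (volume.restrict (Ioo (0 : ℝ) 1))

/-- `g` is the weak derivative of `f` on `(0,1)`. -/
def HasWeakDeriv (f g : L2) : Prop :=
  ∀ φ : ℝ → ℝ, ContDiff ℝ ∞ φ → HasCompactSupport φ → tsupport φ ⊆ Ioo (0 : ℝ) 1 →
    ∫ x in Ioo (0 : ℝ) 1, f x * deriv φ x = - ∫ x in Ioo (0 : ℝ) 1, g x * φ x

theorem exists_pairing (ψ : ℝ → ℝ) (h : Continuous ψ) (hc : HasCompactSupport ψ) :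
    ∃ l : L2 →L[ℝ] ℝ, ∀ f : L2, l f = ∫ x in Ioo (0 : ℝ) 1, f x * ψ x := by
  have hm : MemLp ψ 2 (volume.restrict (Ioo (0 : ℝ) 1)) :=
    (h.memLp_of_hasCompactSupport hc).restrict _
  refine ⟨innerSL ℝ (hm.toLp ψ), fun f => ?_⟩
  rw [innerSL_apply_apply, L2.inner_def]
  refine integral_congr_ae ?_
  filter_upwards [hm.coeFn_toLp] with x hx
  rw [hx]
  simp

theorem exists_defect (φ : ℝ → ℝ) (h : ContDiff ℝ ∞ φ) (hc : HasCompactSupport φ) :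
    ∃ l : WithLp 2 (L2 × L2) →L[ℝ] ℝ, ∀ w, l w = 0 ↔
      ∫ x in Ioo (0 : ℝ) 1, w.fst x * deriv φ x = - ∫ x in Ioo (0 : ℝ) 1, w.snd x * φ x := by
  obtain ⟨l₁, h₁⟩ := exists_pairing (deriv φ) (h.continuous_deriv (by simp)) hc.deriv
  obtain ⟨l₂, h₂⟩ := exists_pairing φ h.continuous hc
  refine ⟨l₁ ∘L WithLp.fstL 2 ℝ L2 L2 + l₂ ∘L WithLp.sndL 2 ℝ L2 L2, fun w => ?_⟩
  rw [← h₁, ← h₂, ← add_eq_zero_iff_eq_neg]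
  rfl

/-- The graph `{(f, f')}` of the weak derivative in `L² × L²`. -/
def weakGraph : Submodule ℝ (WithLp 2 (L2 × L2)) where
  carrier := {w | HasWeakDeriv w.fst w.snd}
  zero_mem' := by
    intro φ h hc _
    obtain ⟨l, hl⟩ := exists_defect φ h hc
    exact (hl 0).1 (map_zero l)
  add_mem' := by
    intro v w hv hw φ h hc hs
    obtain ⟨l, hl⟩ := exists_defect φ h hc
    refine (hl _).1 ?_
    rw [map_add, (hl _).2 (hv φ h hc hs), (hl _).2 (hw φ h hc hs), add_zero]
  smul_mem' := by
    intro r w hw φ h hc hs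
    obtain ⟨l, hl⟩ := exists_defect φ h hc
    refine (hl _).1 ?_
    rw [map_smul, (hl _).2 (hw φ h hc hs), smul_zero]

theorem isClosed_weakGraph : IsClosed (weakGraph : Set (WithLp 2 (L2 × L2))) := by
  rw [← isSeqClosed_iff_isClosed]
  intro w z hw hz φ h hc hs
  obtain ⟨l, hl⟩ := exists_defect φ h hc
  refine (hl z).1 (tendsto_nhds_unique ((l.continuous.tendsto z).comp hz) ?_)
  have : (l ∘ w) = fun _ => 0 := funext fun n => (hl _).2 (hw n φ h hc hs)
  rw [this]
  exact tendsto_const_nhds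

/-- The Sobolev space `H¹(0,1)`: functions `f ∈ L²` with weak derivative `f' ∈ L²`, identified
with the pairs `(f, f')`, so that its norm is `(‖f‖² + ‖f'‖²)^{1/2}`. -/
abbrev H1 : Type := weakGraph

/-- `H¹(0,1)` is complete; in particular Bochner integrals in it are meaningful. -/
instance : CompleteSpace H1 := isClosed_weakGraph.completeSpace_coe

/-- The underlying `L²` function of an element of `H¹(0,1)`. -/
def H1.fn (w : H1) : L2 := w.1.fst

/-- The weak derivative of an element of `H¹(0,1)`. -/
def H1.dx (w : H1) : L2 := w.1.snd

/-- The value at `x ∈ [0,1]` of the continuous representative of an element of `H¹(0,1)`. -/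
def H1.val (w : H1) (x : ℝ) : ℝ :=
  Classical.epsilon (fun g : ℝ → ℝ => ContinuousOn g (Icc (0 : ℝ) 1) ∧
    (w.fn : ℝ → ℝ) =ᵐ[volume.restrict (Ioo (0 : ℝ) 1)] g) x

/-- The state space `H¹(0,1) × L²(0,1) × L²(0,1)` of triples `(u, u_t, p)`. -/
abbrev State : Type := H1 × L2 × L2

/-- The Hilbertian product norm of a triple. -/
def prodNorm {E F G : Type*} [Norm E] [Norm F] [Norm G] (x : E) (y : F) (z : G) : ℝ :=
  √(‖x‖ ^ 2 + ‖y‖ ^ 2 + ‖z‖ ^ 2)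

/-- The graph of the operator `A (u, v, p) = (v, u_xx, ε⁻¹ p_xx)`: the relation says that
`Y = (u, v, p)` is in the domain, i.e. `u ∈ H²`, `v ∈ H¹`, `p ∈ H²` with
`u(0) = v(0) = 0`, `u_x(1) = -a v(1) + b p(0)`, `p_x(0) = c p(0)`, `p_x(1) = d u(1)`,
and that `A Y = Z`. -/
def IsOpValue (ε a b c d : ℝ) (Y Z : State) : Prop :=
  ∃ ux v p px : H1,
    ux.fn = Y.1.dx ∧ v.fn = Y.2.1 ∧ p.fn = Y.2.2 ∧ px.fn = p.dx ∧
    Y.1.val 0 = 0 ∧ v.val 0 = 0 ∧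
    ux.val 1 = -a * v.val 1 + b * p.val 0 ∧
    px.val 0 = c * p.val 0 ∧
    px.val 1 = d * Y.1.val 1 ∧
    Z = (v, ux.dx, ε⁻¹ • px.dx)

/-- `Y = (u, u_t, p)` is a mild solution on `[0,∞)` of the coupled system
`u_tt = u_xx`, `ε p_t = p_xx`, `u(0,t) = 0`, `u_x(1,t) = -a u_t(1,t) + b p(0,t)`,
`p_x(0,t) = c p(0,t)`, `p_x(1,t) = d u(1,t)`, with initial state `Y₀`:
it is continuous into the state space, the integral of `Y` over `[0,t]` is in the domain of `A`,
and `Y(t) = Y₀ + A ∫₀ᵗ Y(s) ds`. -/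
structure IsMildSolution (ε a b c d : ℝ) (Y₀ : State) (Y : ℝ → State) : Prop where
  continuousOn : ContinuousOn Y (Ici 0)
  integrated : ∀ t : ℝ, 0 ≤ t → IsOpValue ε a b c d (∫ s in (0 : ℝ)..t, Y s) (Y t - Y₀)

/-- `Y` is a mild solution and every other one agrees with it on `[0,∞)`. -/
def IsTheMildSolution (ε a b c d : ℝ) (Y₀ : State) (Y : ℝ → State) : Prop :=
  IsMildSolution ε a b c d Y₀ Y ∧
    ∀ Y' : ℝ → State, IsMildSolution ε a b c d Y₀ Y' → EqOn Y' Y (Ici 0)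

/-- The end point `η > 1` of the admissible interval for `a`. -/
def eta : ℝ := (√3 + 1) / (√3 - 1)

/-- The upper bound for `μ`. -/
def muStar (a : ℝ) : ℝ := Real.log (|1 + a| / (√2 * |1 - a|))

/-- `F(μ) = 2 sinh μ + 10 cosh μ`. -/
def F (μ : ℝ) : ℝ := 2 * Real.sinh μ + 10 * Real.cosh μ

/-- The standing conditions on the parameters. -/
structure ParamConditions (a b c d μ : ℝ) : Prop where
  mu_pos : 0 < μ
  mu_le : μ ≤ muStar a
  a_mem : a ∈ Icc eta⁻¹ eta \ {1}
  bd_le : |b * d / c| ≤ 1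
  c_ge : Real.pi ^ 2 / 8 ≤ c
  b_le : 1 + 2 * (Real.sinh μ + 2 * Real.cosh μ) * b ^ 2 ≤ c
  d_le : |d| ≤ 2 * √(μ * Real.exp (-μ))

end WaveHeat

end

noncomputable section

namespace WaveHeat

open Filter Topology NormedSpace

section Abstract

variable {X : Type*} [NormedAddCommGroup X] [NormedSpace ℝ X]

/-- A symmetric coercive continuous bilinear form, i.e. an equivalent inner product. -/
structure IsEnergyForm (B : X →L[ℝ] X →L[ℝ] ℝ) (m : ℝ) : Prop where
  symm : ∀ x y, B x y = B y x
  pos : 0 < m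
  coercive : ∀ x, m * ‖x‖ ^ 2 ≤ B x x

namespace IsEnergyForm

variable {B : X →L[ℝ] X →L[ℝ] ℝ} {m : ℝ}

theorem nonneg (h : IsEnergyForm B m) (x : X) : 0 ≤ B x x :=
  le_trans (mul_nonneg h.pos.le (sq_nonneg _)) (h.coercive x)

theorem apply_self_le (B : X →L[ℝ] X →L[ℝ] ℝ) (x : X) : B x x ≤ ‖B‖ * ‖x‖ ^ 2 := by
  have := (le_abs_self _).trans (B.le_opNorm₂ x x)
  nlinarith

theorem eq_zero (h : IsEnergyForm B m) {x : X} (hx : B x x ≤ 0) : x = 0 := by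
  have h1 := h.coercive x
  have h2 : ‖x‖ ^ 2 ≤ 0 := by
    by_contra hc
    push Not at hc
    nlinarith [mul_pos h.pos hc]
  exact norm_eq_zero.1 (pow_eq_zero_iff two_ne_zero |>.1 (le_antisymm h2 (sq_nonneg _)))

theorem cauchy_schwarz (h : IsEnergyForm B m) (x y : X) : B x y ^ 2 ≤ B x x * B y y := by
  rcases (h.nonneg y).eq_or_lt with hy | hy
  · rw [h.eq_zero hy.symm.le]
    simp
  have h1 := h.nonneg (B y y • x - B x y • y)
  simp only [map_sub, map_smul, _root_.sub_apply, _root_.smul_apply, smul_eq_mul, h.symm y x] at h1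
  have h2 : 0 ≤ B y y * (B x x * B y y - B x y ^ 2) := by linarith
  linarith [(mul_nonneg_iff_of_pos_left hy).1 h2]

/-- A bound in the energy form gives a bound in norm. -/
theorem norm_le (h : IsEnergyForm B m) {x y : X} (hxy : B x x ≤ B y y) :
    ‖x‖ ≤ √(‖B‖ / m) * ‖y‖ := by
  rw [← Real.sqrt_sq (norm_nonneg y), ← Real.sqrt_mul (div_nonneg (norm_nonneg B) h.pos.le)]
  refine Real.le_sqrt_of_sq_le ?_
  rw [div_mul_eq_mul_div, le_div_iff₀ h.pos]
  linarith [h.coercive x, apply_self_le B y]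

theorem exists_norm_le (h : IsEnergyForm B m) :
    ∃ C : ℝ, 0 ≤ C ∧ ∀ x y, B x x ≤ B y y → ‖x‖ ≤ C * ‖y‖ :=
  ⟨_, Real.sqrt_nonneg _, fun _ _ => h.norm_le⟩

theorem hasDerivWithinAt (h : IsEnergyForm B m) {y : ℝ → X} {y' : X} {s : Set ℝ} {t : ℝ}
    (hy : HasDerivWithinAt y y' s t) :
    HasDerivWithinAt (fun t => B (y t) (y t)) (2 * B y' (y t)) s t := by
  have h1 := (B.hasFDerivAt.comp_hasDerivWithinAt t hy).clm_apply hy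
  have e : B y' (y t) + B (y t) y' = 2 * B y' (y t) := by rw [h.symm (y t)]; ring
  rw [← e]
  exact h1

/-- Exponential decay of the energy for a differentiable curve. -/
theorem decay (h : IsEnergyForm B m) {y y' : ℝ → X} {r : ℝ}
    (hy : ∀ t, 0 ≤ t → HasDerivWithinAt y (y' t) (Ici 0) t)
    (hr : ∀ t, 0 ≤ t → B (y' t) (y t) ≤ -r * B (y t) (y t)) {t : ℝ} (ht : 0 ≤ t) :
    B (y t) (y t) ≤ Real.exp (-(2 * r) * t) * B (y 0) (y 0) := by
  have hd : ∀ s, 0 ≤ s → HasDerivWithinAt (fun s => Real.exp (2 * r * s) * B (y s) (y s))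
      (Real.exp (2 * r * s) * (2 * r) * B (y s) (y s) +
        Real.exp (2 * r * s) * (2 * B (y' s) (y s))) (Ici 0) s := fun s hs => by
    have h1 : HasDerivAt (fun s => Real.exp (2 * r * s)) (Real.exp (2 * r * s) * (2 * r)) s := by
      simpa using ((hasDerivAt_id s).const_mul (2 * r)).exp
    exact h1.hasDerivWithinAt.mul (h.hasDerivWithinAt (hy s hs))
  have hanti : AntitoneOn (fun s => Real.exp (2 * r * s) * B (y s) (y s)) (Ici 0) := by
    refine antitoneOn_of_hasDerivWithinAt_nonpos (convex_Ici 0)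
      (fun s hs => (hd s hs).continuousWithinAt)
      (fun s hs => (hd s (interior_subset hs)).mono interior_subset) (fun s hs => ?_)
    have h2 := hr s (interior_subset hs)
    have h3 := Real.exp_pos (2 * r * s)
    nlinarith
  have h4 := hanti (self_mem_Ici (a := (0 : ℝ))) (mem_Ici.2 ht) ht
  simp only [mul_zero, Real.exp_zero, one_mul] at h4
  have h5 : Real.exp (-(2 * r) * t) * Real.exp (2 * r * t) = 1 := by
    rw [← Real.exp_add]; simp
  calc B (y t) (y t) = Real.exp (-(2 * r) * t) * (Real.exp (2 * r * t) * B (y t) (y t)) := by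
        rw [← mul_assoc, h5, one_mul]
    _ ≤ _ := mul_le_mul_of_nonneg_left h4 (Real.exp_pos _).le

end IsEnergyForm

theorem hasDerivAt_exp_smul_apply [CompleteSpace X] (A : X →L[ℝ] X) (x : X) (t : ℝ) :
    HasDerivAt (fun t : ℝ => exp (t • A) x) (A (exp (t • A) x)) t := by
  have h1 := (hasDerivAt_exp_smul_const' (𝕂 := ℝ) A t).clm_apply (hasDerivAt_const t x)
  simpa using h1

theorem IsEnergyForm.exp_decay [CompleteSpace X] {B : X →L[ℝ] X →L[ℝ] ℝ} {m : ℝ}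
    (h : IsEnergyForm B m) {A : X →L[ℝ] X} {r : ℝ} (hA : ∀ x, B (A x) x ≤ -r * B x x) (x : X)
    {t : ℝ} (ht : 0 ≤ t) :
    B (exp (t • A) x) (exp (t • A) x) ≤ Real.exp (-(2 * r) * t) * B x x := by
  have := h.decay (y := fun t => exp (t • A) x)
    (fun s _ => (hasDerivAt_exp_smul_apply A x s).hasDerivWithinAt) (fun s _ => hA _) ht
  simpa using this

theorem IsEnergyForm.norm_exp_le [CompleteSpace X] {B : X →L[ℝ] X →L[ℝ] ℝ} {m : ℝ}
    (h : IsEnergyForm B m) {A : X →L[ℝ] X} {r : ℝ} (hr : 0 ≤ r) (hA : ∀ x, B (A x) x ≤ -r * B x x)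
    (x : X) {t : ℝ} (ht : 0 ≤ t) : ‖exp (t • A) x‖ ≤ √(‖B‖ / m) * ‖x‖ := by
  refine h.norm_le ((h.exp_decay hA x ht).trans ?_)
  refine mul_le_of_le_one_left (h.nonneg x) (Real.exp_le_one_iff.2 ?_)
  have := mul_nonneg hr ht
  linarith

/-- `K` is the (bounded) inverse of an operator that is dissipative with margin `ρ`. -/
structure IsDissipativeInverse (B : X →L[ℝ] X →L[ℝ] ℝ) (K : X →L[ℝ] X) (ρ : ℝ) : Prop where
  pos : 0 < ρ
  le : ∀ z, B (K z) z ≤ -ρ * B (K z) (K z)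
  inj : ∀ z, K z = 0 → z = 0

section Yosida

variable {B : X →L[ℝ] X →L[ℝ] ℝ} {m ρ : ℝ} {K : X →L[ℝ] X}

/-- The Lax-Milgram theorem on a space isomorphic to a Hilbert space. -/
theorem lax_milgram {H : Type*} [NormedAddCommGroup H] [InnerProductSpace ℝ H]
    [CompleteSpace H] (Φ : X ≃L[ℝ] H) (b : X →L[ℝ] X →L[ℝ] ℝ) {C : ℝ} (hC : 0 < C)
    (hb : ∀ x, C * ‖x‖ ^ 2 ≤ b x x) (l : X →L[ℝ] ℝ) : ∃ y, ∀ x, b y x = l x := by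
  let Ψ : H →L[ℝ] X := Φ.symm
  let b' : H →L[ℝ] H →L[ℝ] ℝ := b.bilinearComp Ψ Ψ
  have hb' : ∀ h h', b' h h' = b (Ψ h) (Ψ h') := fun h h' => rfl
  have hcoer : IsCoercive b' := by
    refine ⟨C * (‖(Φ : X →L[ℝ] H)‖ + 1)⁻¹ ^ 2, by positivity, fun u => ?_⟩
    have h1 : ‖u‖ ≤ (‖(Φ : X →L[ℝ] H)‖ + 1) * ‖Ψ u‖ := by
      calc ‖u‖ = ‖(Φ : X →L[ℝ] H) (Ψ u)‖ := by simp [Ψ]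
        _ ≤ ‖(Φ : X →L[ℝ] H)‖ * ‖Ψ u‖ := ContinuousLinearMap.le_opNorm _ _
        _ ≤ _ := by gcongr; linarith
    have h2 : (‖(Φ : X →L[ℝ] H)‖ + 1)⁻¹ * ‖u‖ ≤ ‖Ψ u‖ := by
      rw [inv_mul_le_iff₀ (by positivity)]; exact h1
    calc C * (‖(Φ : X →L[ℝ] H)‖ + 1)⁻¹ ^ 2 * ‖u‖ * ‖u‖
        = C * ((‖(Φ : X →L[ℝ] H)‖ + 1)⁻¹ * ‖u‖) ^ 2 := by ring
      _ ≤ C * ‖Ψ u‖ ^ 2 := by gcongr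
      _ ≤ b' u u := hb _
  let e := (InnerProductSpace.toDual ℝ H).symm (l ∘L Ψ)
  have he : ∀ h, inner ℝ e h = l (Ψ h) := fun h => by
    simp [e, InnerProductSpace.toDual_symm_apply]
  refine ⟨Ψ (hcoer.continuousLinearEquivOfBilin.symm e), fun x => ?_⟩
  have h4 : Ψ (Φ x) = x := Φ.symm_apply_apply x
  rw [← h4, ← hb', ← hcoer.continuousLinearEquivOfBilin_apply,
    ContinuousLinearEquiv.apply_symm_apply, he]

/-- Invertibility of `K - δ`. -/
theorem exists_yosida [CompleteSpace X] {H : Type*} [NormedAddCommGroup H] [InnerProductSpace ℝ H]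
    [CompleteSpace H] (Φ : X ≃L[ℝ] H) (hB : IsEnergyForm B m) (hK : IsDissipativeInverse B K ρ)
    {δ : ℝ} (hδ : 0 < δ) :
    ∃ A : X →L[ℝ] X, (∀ x, K (A x) - δ • A x = x) ∧ ∀ z, A (K z - δ • z) = z := by
  let S : X →L[ℝ] X := K - δ • ContinuousLinearMap.id ℝ X
  have hS : ∀ z, S z = K z - δ • z := fun z => rfl
  have hco : ∀ z, B (S z) z ≤ -δ * B z z := fun z => by
    have h1 := hK.le z
    have h2 := mul_nonneg hK.pos.le (hB.nonneg (K z))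
    simp only [hS, map_sub, map_smul, _root_.sub_apply, _root_.smul_apply, smul_eq_mul]
    linarith
  have hinj : ∀ z, S z = 0 → z = 0 := fun z hz => by
    have h1 := hco z
    rw [hz] at h1
    simp only [map_zero, _root_.zero_apply] at h1
    exact hB.eq_zero (by nlinarith)
  have hsurj : Function.Surjective S := fun y => by
    obtain ⟨z, hz⟩ := lax_milgram Φ (-(B ∘L S)) (mul_pos hδ hB.pos) (fun x => by
      have h1 := hco x
      have h2 := mul_le_mul_of_nonneg_left (hB.coercive x) hδ.le
      change _ ≤ -B (S x) x
      linarith) (-B y)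
    refine ⟨z, sub_eq_zero.1 (hB.eq_zero (le_of_eq ?_))⟩
    have h3 : -B (S z) (S z - y) = -B y (S z - y) := hz (S z - y)
    rw [map_sub B, _root_.sub_apply]
    linarith
  have hker : S.ker = ⊥ := LinearMap.ker_eq_bot'.2 hinj
  let E := ContinuousLinearEquiv.ofBijective S hker (LinearMap.range_eq_top.2 hsurj)
  have hE : ∀ z, E z = K z - δ • z := fun z => rfl
  exact ⟨E.symm, fun x => (hE _).symm.trans (E.apply_symm_apply x), fun z => by
    rw [← hE]; exact E.symm_apply_apply z⟩

theorem yosida_dissipative (hB : IsEnergyForm B m) (hK : IsDissipativeInverse B K ρ)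
    {δ : ℝ} (hδ : 0 < δ) {A : X →L[ℝ] X} (hA : ∀ x, K (A x) - δ • A x = x) (x : X) :
    B (A x) x ≤ -(ρ / (1 + δ * ρ)) * B x x := by
  set z := A x with hz
  have hx : x = K z - δ • z := (hA x).symm
  have h1 := hK.le z
  have hρ := hK.pos
  have h3 := hB.nonneg z
  have h4 := hB.nonneg (K z)
  have h5 := hB.symm z (K z)
  have e1 : B z x = B (K z) z - δ * B z z := by
    rw [hx]; simp [h5]
  have e2 : B x x = B (K z) (K z) - 2 * δ * B (K z) z + δ ^ 2 * B z z := by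
    rw [hx]; simp [h5]; ring
  have hpos : 0 < 1 + δ * ρ := by positivity
  have h6 : 0 ≤ ρ ^ 2 * B (K z) (K z) + 2 * ρ * B (K z) z + B z z := by
    have := hB.nonneg (ρ • K z + z)
    simp only [map_add, map_smul, _root_.add_apply, _root_.smul_apply,
      smul_eq_mul, h5] at this
    linarith
  rw [e1, e2, neg_mul, div_mul_eq_mul_div, le_neg, ← sub_nonneg]
  have : -(B (K z) z - δ * B z z) - ρ * (B (K z) (K z) - 2 * δ * B (K z) z + δ ^ 2 * B z z) /
      (1 + δ * ρ) = ((-B (K z) z - ρ * B (K z) (K z)) + δ * (ρ * B (K z) z + B z z)) / (1 + δ * ρ)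
      := by
    field_simp
    ring
  rw [this]
  refine div_nonneg ?_ hpos.le
  nlinarith
theorem yosida_comp_le (hB : IsEnergyForm B m) (hK : IsDissipativeInverse B K ρ)
    {δ : ℝ} (hδ : 0 < δ) {A : X →L[ℝ] X} (hA : ∀ x, K (A x) - δ • A x = x) (x : X) :
    B (K (A x)) (K (A x)) ≤ B x x := by
  set z := A x with hz
  have hx : x = K z - δ • z := (hA x).symm
  have h1 := hK.le z
  have h2 := mul_nonneg hK.pos.le (hB.nonneg (K z))
  have h5 := hB.symm z (K z)
  have e2 : B x x = B (K z) (K z) - 2 * δ * B (K z) z + δ ^ 2 * B z z := by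
    rw [hx]; simp [h5]; ring
  have h3 := mul_nonneg (sq_nonneg δ) (hB.nonneg z)
  have h4 : 0 ≤ δ * (-B (K z) z) := mul_nonneg hδ.le (by linarith)
  linarith

theorem yosida_commute {δ δ' : ℝ} {A A' : X →L[ℝ] X} (hA₁ : ∀ x, K (A x) - δ • A x = x)
    (hA₂ : ∀ z, A (K z - δ • z) = z) (hA₁' : ∀ x, K (A' x) - δ' • A' x = x)
    (hA₂' : ∀ z, A' (K z - δ' • z) = z) : Commute A A' := by
  ext x
  change A (A' x) = A' (A x)
  set y := A (A' x) with hy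
  have h1 : K y - δ • y = A' x := hA₁ _
  have h2 : K (K y - δ • y) - δ' • (K y - δ • y) = x := by rw [h1]; exact hA₁' x
  have h3 : x = K (K y - δ' • y) - δ • (K y - δ' • y) := by
    rw [← h2]; simp only [map_sub, map_smul, smul_sub, smul_comm δ δ']; abel
  rw [h3, hA₂, hA₂']

theorem yosida_diff_le [CompleteSpace X] (hB : IsEnergyForm B m) (hK : IsDissipativeInverse B K ρ)
    {δ δ' : ℝ} (hδ : 0 < δ) (hδ' : 0 < δ')
    {A A' : X →L[ℝ] X} (hA₁ : ∀ x, K (A x) - δ • A x = x)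
    (hA₂ : ∀ z, A (K z - δ • z) = z) (hA₁' : ∀ x, K (A' x) - δ' • A' x = x)
    (hA₂' : ∀ z, A' (K z - δ' • z) = z) (w : X) {t : ℝ} (ht : 0 ≤ t) :
    ‖exp (t • A) (K (K w)) - exp (t • A') (K (K w))‖ ≤
      √(‖B‖ / m) ^ 3 * ((δ + δ') * ‖w‖) * t := by
  set M := √(‖B‖ / m)
  set x := K (K w)
  have hM : 0 ≤ M := Real.sqrt_nonneg _
  have hr : ∀ {δ : ℝ}, 0 < δ → 0 ≤ ρ / (1 + δ * ρ) := fun hδ => by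
    have := hK.pos; positivity
  have hc := yosida_commute hA₁ hA₂ hA₁' hA₂'
  have key : ∀ {δ : ℝ} {A : X →L[ℝ] X}, 0 < δ → (∀ x, K (A x) - δ • A x = x) →
      (∀ z, A (K z - δ • z) = z) → ‖A x - K w‖ ≤ M * (δ * ‖w‖) := by
    intro δ A hδ h1 h2
    have hcomm : ∀ z, A (K z) = K (A z) := fun z => by
      have e1 := h2 z
      have e2 := h1 z
      rw [map_sub, map_smul] at e1
      rw [sub_eq_iff_eq_add] at e1 e2
      rw [e1, e2]
    have e1 := h2 (K w)
    rw [map_sub, map_smul, sub_eq_iff_eq_add, hcomm w] at e1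
    have e2 : A x - K w = δ • K (A w) := by
      change A (K (K w)) - K w = _
      rw [e1]; abel
    rw [e2, norm_smul, Real.norm_of_nonneg hδ.le, mul_left_comm]
    exact mul_le_mul_of_nonneg_left (hB.norm_le (yosida_comp_le hB hK hδ h1 w)) hδ.le
  have hbd : ‖A x - A' x‖ ≤ M * ((δ + δ') * ‖w‖) := by
    have h1 := key hδ hA₁ hA₂
    have h2 := key hδ' hA₁' hA₂'
    have e : A x - A' x = (A x - K w) - (A' x - K w) := by abel
    rw [e]
    refine (norm_sub_le _ _).trans ?_
    linarith
  have hE : ∀ (s : ℝ), 0 ≤ s → ∀ y, ‖exp (s • A) y‖ ≤ M * ‖y‖ := fun s hs y =>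
    hB.norm_exp_le (hr hδ) (yosida_dissipative hB hK hδ hA₁) y hs
  have hE' : ∀ (s : ℝ), 0 ≤ s → ∀ y, ‖exp (s • A') y‖ ≤ M * ‖y‖ := fun s hs y =>
    hB.norm_exp_le (hr hδ') (yosida_dissipative hB hK hδ' hA₁') y hs
  have hd : ∀ s ∈ Icc (0 : ℝ) t, HasDerivWithinAt (fun s => exp (s • A) (exp ((t - s) • A') x))
      (exp (s • A) (exp ((t - s) • A') (A x - A' x))) (Icc 0 t) s := by
    intro s _
    have h1 := hasDerivAt_exp_smul_const (𝕂 := ℝ) A s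
    have h2 : HasDerivAt (fun s => exp ((t - s) • A') x) (-(A' (exp ((t - s) • A') x))) s := by
      have := (hasDerivAt_exp_smul_apply A' x (t - s)).scomp s ((hasDerivAt_id s).const_sub t)
      simpa [Function.comp_def] using this
    have h3 := (h1.clm_apply h2).hasDerivWithinAt (s := Icc 0 t)
    refine h3.congr_deriv ?_
    have c1 : A (exp ((t - s) • A') x) = exp ((t - s) • A') (A x) := by
      have := (hc.smul_right (t - s)).exp_right
      exact congrArg (fun T : X →L[ℝ] X => T x) this.eq
    have c2 : A' (exp ((t - s) • A') x) = exp ((t - s) • A') (A' x) := by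
      have := ((Commute.refl A').smul_right (t - s)).exp_right
      exact congrArg (fun T : X →L[ℝ] X => T x) this.eq
    change exp (s • A) (A (exp ((t - s) • A') x)) + exp (s • A) (-(A' (exp ((t - s) • A') x))) = _
    rw [c1, c2, ← map_add, ← sub_eq_add_neg, ← map_sub]
  have h := norm_image_sub_le_of_norm_deriv_le_segment' hd
    (C := M ^ 3 * ((δ + δ') * ‖w‖)) (fun s hs => ?_) t (right_mem_Icc.2 ht)
  · simpa using h
  · calc _ ≤ M * ‖exp ((t - s) • A') (A x - A' x)‖ := hE s hs.1 _
      _ ≤ M * (M * ‖A x - A' x‖) := by gcongr; exact hE' _ (by linarith [hs.2]) _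
      _ ≤ M * (M * (M * ((δ + δ') * ‖w‖))) := by gcongr
      _ = _ := by ring

theorem IsDissipativeInverse.denseRange [CompleteSpace X] {H : Type*} [NormedAddCommGroup H]
    [InnerProductSpace ℝ H] [CompleteSpace H] (Φ : X ≃L[ℝ] H) (hB : IsEnergyForm B m)
    (hK : IsDissipativeInverse B K ρ) : DenseRange K := by
  intro x
  by_contra hx
  have hconv : Convex ℝ (closure (range K)) := by
    have : range K = (K.range : Set X) := by ext; simp
    rw [this]
    exact K.range.convex.closure
  obtain ⟨l, u, hlx, hl⟩ := geometric_hahn_banach_point_closed hconv isClosed_closure hx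
  have hl' : ∀ z, u < l (K z) := fun z => hl _ (subset_closure (mem_range_self z))
  have hu : u < 0 := by simpa using hl' 0
  have hlK : ∀ z, l (K z) = 0 := fun z => by
    by_contra hne
    have h1 := hl' ((u / l (K z)) • z)
    rw [map_smul, map_smul, smul_eq_mul, div_mul_cancel₀ _ hne] at h1
    exact lt_irrefl _ h1
  obtain ⟨y, hy⟩ := lax_milgram Φ B hB.pos hB.coercive l
  have h1 := hK.le y
  rw [hB.symm, hy, hlK] at h1
  have h2 : y = 0 := hK.inj y (hB.eq_zero (by nlinarith [hK.pos]))
  have h3 := hy x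
  rw [h2] at h3
  simp only [map_zero, _root_.zero_apply] at h3
  linarith

end Yosida

/-- Existence and decay of mild solutions for an operator with dissipative bounded inverse `K`. -/
theorem exists_mild_solution [CompleteSpace X] {H : Type*} [NormedAddCommGroup H]
    [InnerProductSpace ℝ H] [CompleteSpace H] (Φ : X ≃L[ℝ] H) {B : X →L[ℝ] X →L[ℝ] ℝ} {m ρ : ℝ}
    {K : X →L[ℝ] X} (hB : IsEnergyForm B m) (hK : IsDissipativeInverse B K ρ) (x₀ : X) :
    ∃ Y : ℝ → X, ContinuousOn Y (Ici 0) ∧ ∀ t, 0 ≤ t → K (Y t - x₀) = ∫ s in (0 : ℝ)..t, Y s ∧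
      B (Y t) (Y t) ≤ Real.exp (-(2 * ρ) * t) * B x₀ x₀ := by
  have hδ : ∀ n : ℕ, (0 : ℝ) < 1 / ((n : ℝ) + 1) := fun n => Nat.one_div_pos_of_nat
  have hδ0 : Tendsto (fun n : ℕ => (1 : ℝ) / ((n : ℝ) + 1)) atTop (𝓝 0) :=
    tendsto_one_div_add_atTop_nhds_zero_nat
  choose A hA₁ hA₂ using fun n => exists_yosida Φ hB hK (hδ n)
  set δ : ℕ → ℝ := fun n => 1 / ((n : ℝ) + 1) with hδdef
  set M := √(‖B‖ / m)
  have hM : 0 ≤ M := Real.sqrt_nonneg _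
  have hE : ∀ n (t : ℝ), 0 ≤ t → ∀ y, ‖exp (t • A n) y‖ ≤ M * ‖y‖ := fun n t ht y =>
    hB.norm_exp_le (by have := hK.pos; have := hδ n; positivity)
      (yosida_dissipative hB hK (hδ n) (hA₁ n)) y ht
  have hcau : ∀ T : ℝ, UniformCauchySeqOn (fun n t => exp (t • A n) x₀) atTop (Icc 0 T) := by
    intro T
    rw [Metric.uniformCauchySeqOn_iff]
    intro e he
    have hd : DenseRange (K ∘ K) := (hK.denseRange Φ hB).comp (hK.denseRange Φ hB) K.continuous
    obtain ⟨w, hw⟩ := hd.exists_dist_lt x₀ (ε := e / (3 * (M + 1))) (by positivity)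
    have hlim : Tendsto (fun n => M ^ 3 * ((δ n + δ n) * ‖w‖) * |T|) atTop (𝓝 0) := by
      have := ((((hδ0.add hδ0).mul_const ‖w‖).const_mul (M ^ 3)).mul_const |T|)
      simpa using this
    obtain ⟨N, hN⟩ := (hlim.eventually_lt_const (show 0 < e / 3 by positivity)).exists
    have hanti : ∀ n, N ≤ n → δ n ≤ δ N := fun n hn => by
      simp only [hδdef]; gcongr
    refine ⟨N, fun i hi j hj t ht => ?_⟩
    have h1 := yosida_diff_le hB hK (hδ i) (hδ j) (hA₁ i) (hA₂ i) (hA₁ j) (hA₂ j) w ht.1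
    have h2 : M ^ 3 * ((1 / ((i : ℝ) + 1) + 1 / ((j : ℝ) + 1)) * ‖w‖) * t ≤
        M ^ 3 * ((δ N + δ N) * ‖w‖) * |T| := by
      have a1 := hanti i hi
      have a2 := hanti j hj
      have a3 : t ≤ |T| := ht.2.trans (le_abs_self T)
      have a4 := ht.1
      have a5 := hδ N
      exact mul_le_mul (by gcongr) a3 a4 (by positivity)
    have h3 : ∀ n, ‖exp (t • A n) x₀ - exp (t • A n) (K (K w))‖ ≤ e / 3 := fun n => by
      rw [← map_sub]
      refine (hE n t ht.1 _).trans ?_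
      rw [dist_eq_norm, lt_div_iff₀ (by positivity)] at hw
      have := norm_nonneg (x₀ - (K ∘ K) w)
      simp only [Function.comp] at hw this ⊢
      nlinarith
    have h4 := h3 i
    have h5 := h3 j
    rw [norm_sub_rev] at h5
    rw [dist_eq_norm]
    have e1 : exp (t • A i) x₀ - exp (t • A j) x₀ =
      (exp (t • A i) x₀ - exp (t • A i) (K (K w))) +
      (exp (t • A i) (K (K w)) - exp (t • A j) (K (K w))) +
      (exp (t • A j) (K (K w)) - exp (t • A j) x₀) := by abel
    rw [e1]
    refine (norm_add₃_le).trans_lt ?_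
    linarith
  have hpt : ∀ t : ℝ, ∃ y, 0 ≤ t → Tendsto (fun n => exp (t • A n) x₀) atTop (𝓝 y) := by
    intro t
    by_cases ht : 0 ≤ t
    · obtain ⟨y, hy⟩ := cauchySeq_tendsto_of_complete ((hcau t).cauchySeq (right_mem_Icc.2 ht))
      exact ⟨y, fun _ => hy⟩
    · exact ⟨0, fun h => absurd h ht⟩
  choose Y hY using hpt
  have hcn : ∀ n, Continuous fun t : ℝ => exp (t • A n) x₀ := fun n =>
    continuous_iff_continuousAt.2 fun t => (hasDerivAt_exp_smul_apply (A n) x₀ t).continuousAt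
  refine ⟨Y, fun t ht => ?_, fun t ht => ⟨?_, ?_⟩⟩
  · have h1 : ContinuousOn Y (Icc 0 (t + 1)) :=
      ((hcau (t + 1)).tendstoUniformlyOn_of_tendsto fun s hs => hY s hs.1).continuousOn
        (Eventually.of_forall fun n => (hcn n).continuousOn).frequently
    refine (h1 t ⟨ht, (lt_add_one t).le⟩).mono_of_mem_nhdsWithin ?_
    filter_upwards [self_mem_nhdsWithin,
      mem_nhdsWithin_of_mem_nhds (Iio_mem_nhds (lt_add_one t))] with s h1 h2
    exact ⟨h1, h2.le⟩
  · have h1 : ∀ n, K (exp (t • A n) x₀ - x₀) - δ n • (exp (t • A n) x₀ - x₀) =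
        ∫ s in (0 : ℝ)..t, exp (s • A n) x₀ := fun n => by
      have h2 : ∫ s in (0 : ℝ)..t, A n (exp (s • A n) x₀) = exp (t • A n) x₀ - x₀ := by
        rw [intervalIntegral.integral_eq_sub_of_hasDerivAt
          (fun s _ => hasDerivAt_exp_smul_apply (A n) x₀ s)
          (((A n).continuous.comp (hcn n)).intervalIntegrable _ _)]
        simp
      rw [← h2, (A n).intervalIntegral_comp_comm ((hcn n).intervalIntegrable _ _), hA₁]
    have h3 : Tendsto (fun n => ∫ s in (0 : ℝ)..t, exp (s • A n) x₀) atTop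
        (𝓝 (∫ s in (0 : ℝ)..t, Y s)) := by
      refine intervalIntegral.tendsto_integral_filter_of_dominated_convergence
        (fun _ => M * ‖x₀‖) (Eventually.of_forall fun n => (hcn n).aestronglyMeasurable)
        (Eventually.of_forall fun n => Eventually.of_forall fun s hs => ?_)
        intervalIntegrable_const (Eventually.of_forall fun s hs => ?_)
      · rw [uIoc_of_le ht] at hs
        exact hE n s hs.1.le _
      · rw [uIoc_of_le ht] at hs
        exact hY s hs.1.le
    have h4 : Tendsto (fun n => K (exp (t • A n) x₀ - x₀) - δ n • (exp (t • A n) x₀ - x₀)) atTop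
        (𝓝 (K (Y t - x₀) - (0 : ℝ) • (Y t - x₀))) :=
      ((K.continuous.tendsto _).comp ((hY t ht).sub_const x₀)).sub
        (hδ0.smul ((hY t ht).sub_const x₀))
    rw [zero_smul, sub_zero] at h4
    refine tendsto_nhds_unique h4 (h3.congr fun n => (h1 n).symm)
  · have hc : Continuous fun y => B y y := B.continuous.clm_apply continuous_id
    have h1 := (hc.tendsto _).comp (hY t ht)
    have h2 : Tendsto (fun n => Real.exp (-(2 * (ρ / (1 + δ n * ρ))) * t) * B x₀ x₀) atTop
        (𝓝 (Real.exp (-(2 * (ρ / (1 + 0 * ρ))) * t) * B x₀ x₀)) := by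
      refine Tendsto.mul_const _ ((Real.continuous_exp.tendsto _).comp ?_)
      refine Tendsto.mul_const _ (Tendsto.neg (Tendsto.const_mul _ ?_))
      exact tendsto_const_nhds.div ((hδ0.mul_const ρ).const_add 1) (by simp)
    simp only [zero_mul, add_zero, div_one] at h2
    exact le_of_tendsto_of_tendsto' h1 h2 fun n =>
      hB.exp_decay (yosida_dissipative hB hK (hδ n) (hA₁ n)) x₀ ht

/-- Uniqueness of mild solutions. -/
theorem mild_solution_unique [CompleteSpace X] {B : X →L[ℝ] X →L[ℝ] ℝ} {m ρ : ℝ}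
    {K : X →L[ℝ] X} (hB : IsEnergyForm B m) (hK : IsDissipativeInverse B K ρ) {Y : ℝ → X}
    (hY : ContinuousOn Y (Ici 0)) (h : ∀ t, 0 ≤ t → K (Y t) = ∫ s in (0 : ℝ)..t, Y s)
    {t : ℝ} (ht : 0 ≤ t) : Y t = 0 := by
  have hd : ∀ t, 0 ≤ t → HasDerivWithinAt (fun t => K (Y t)) (Y t) (Ici 0) t := by
    intro t ht
    have h1 : HasDerivWithinAt (fun t => ∫ s in (0 : ℝ)..t, Y s) (Y t) (Ici 0) t := by
      have hc : Continuous fun s => Y (max s 0) :=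
        hY.comp_continuous (by fun_prop) fun s => le_max_right s 0
      have h2 := (hc.integral_hasStrictDerivAt 0 t).hasDerivAt.hasDerivWithinAt (s := Ici 0)
      have h3 : ∀ u ∈ Ici (0 : ℝ), ∫ s in (0 : ℝ)..u, Y s = ∫ s in (0 : ℝ)..u, Y (max s 0) :=
        fun u hu => intervalIntegral.integral_congr fun s hs => by
          rw [uIcc_of_le hu] at hs
          simp only [max_eq_left hs.1]
      simp only [max_eq_left ht] at h2
      exact h2.congr h3 (h3 t ht)
    exact h1.congr (fun s hs => h s hs) (h t ht)
  have h1 := hB.decay (r := 0) hd (fun t _ => by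
    rw [hB.symm]
    have := hK.le (Y t)
    have := mul_nonneg hK.pos.le (hB.nonneg (K (Y t)))
    linarith) ht
  rw [h 0 le_rfl] at h1
  simp only [intervalIntegral.integral_same, map_zero, mul_zero] at h1
  exact hK.inj _ (hB.eq_zero h1)

end Abstract

/-! ### The Sobolev space `H¹(0,1)` -/

instance : IsProbabilityMeasure (volume.restrict (Ioo (0 : ℝ) 1)) :=
  ⟨by simp⟩

theorem setIntegral_Ioo_eq (g : ℝ → ℝ) :
    ∫ x in Ioo (0 : ℝ) 1, g x = ∫ x in (0 : ℝ)..1, g x := by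
  rw [intervalIntegral.integral_of_le zero_le_one, integral_Ioc_eq_integral_Ioo]

theorem ae_restrict_Ioo_iff {p : ℝ → Prop} :
    (∀ᵐ x ∂volume.restrict (Ioo (0 : ℝ) 1), p x) ↔ ∀ᵐ x, x ∈ Ioo (0 : ℝ) 1 → p x :=
  ae_restrict_iff' measurableSet_Ioo

theorem L2.integrable (f : L2) : Integrable f (volume.restrict (Ioo (0 : ℝ) 1)) :=
  (Lp.memLp f).integrable one_le_two

theorem L2.intervalIntegrable (f : L2) : IntervalIntegrable f volume 0 1 := by
  rw [intervalIntegrable_iff_integrableOn_Ioo_of_le zero_le_one]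
  exact f.integrable

theorem L2.inner_eq (f g : L2) : inner ℝ f g = ∫ x in Ioo (0 : ℝ) 1, f x * g x := by
  rw [MeasureTheory.L2.inner_def]
  exact integral_congr_ae (Eventually.of_forall fun x => by simp [mul_comm])

theorem L2.norm_sq_eq (f : L2) : ‖f‖ ^ 2 = ∫ x in Ioo (0 : ℝ) 1, f x ^ 2 := by
  rw [← real_inner_self_eq_norm_sq, L2.inner_eq]
  simp [sq]

theorem L2.integrable_mul (f g : L2) :
    Integrable (fun x => f x * g x) (volume.restrict (Ioo (0 : ℝ) 1)) :=
  MemLp.integrable_mul (Lp.memLp f) (Lp.memLp g)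

/-- Integration from `0` to `x` is a functional of norm at most one. -/
theorem exists_integral_clm {x : ℝ} (hx : x ∈ Icc (0 : ℝ) 1) :
    ∃ l : L2 →L[ℝ] ℝ, (∀ f, |l f| ≤ ‖f‖) ∧ ∀ f : L2, l f = ∫ s in (0 : ℝ)..x, f s := by
  have hs : MeasurableSet (Ioc (0 : ℝ) x) := measurableSet_Ioc
  have hne : volume.restrict (Ioo (0 : ℝ) 1) (Ioc 0 x) ≠ ⊤ := measure_ne_top _ _
  refine ⟨innerSL ℝ (indicatorConstLp 2 hs hne (1 : ℝ)), fun f => ?_, fun f => ?_⟩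
  · rw [innerSL_apply_apply]
    refine (abs_real_inner_le_norm _ _).trans (mul_le_of_le_one_left (norm_nonneg _) ?_)
    refine norm_indicatorConstLp_le.trans ?_
    rw [norm_one, one_mul]
    exact Real.rpow_le_one measureReal_nonneg measureReal_le_one (by simp)
  · rw [innerSL_apply_apply, L2.inner_indicatorConstLp_one, intervalIntegral.integral_of_le hx.1,
      Measure.restrict_restrict hs]
    have h1 : (Ioc 0 x ∩ Ioo (0 : ℝ) 1 : Set ℝ) =ᵐ[volume] (Ioc 0 x : Set ℝ) := by
      have h2 : (Ioc 0 x ∩ Ioo (0 : ℝ) 1 : Set ℝ) =ᵐ[volume] (Ioc 0 x ∩ Ioc (0 : ℝ) 1 : Set ℝ) :=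
        (ae_eq_refl _).inter Ioo_ae_eq_Ioc
      rwa [inter_eq_left.2 (Ioc_subset_Ioc_right hx.2)] at h2
    rw [Measure.restrict_congr_set h1]

/-- The function `x ↦ k + ∫₀ˣ f`. -/
def primFun (k : ℝ) (f : L2) (x : ℝ) : ℝ := k + ∫ s in (0 : ℝ)..x, f s

@[simp] theorem primFun_zero (k : ℝ) (f : L2) : primFun k f 0 = k := by simp [primFun]

theorem primFun_ac (k : ℝ) (f : L2) : AbsolutelyContinuousOnInterval (primFun k f) 0 1 := by
  have h1 := f.intervalIntegrable.absolutelyContinuousOnInterval_intervalIntegral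
    (c := 0) (by simp)
  have h2 : AbsolutelyContinuousOnInterval (fun _ : ℝ => k) 0 1 :=
    ContDiffOn.absolutelyContinuousOnInterval contDiffOn_const
  exact h2.add h1

theorem primFun_continuousOn (k : ℝ) (f : L2) : ContinuousOn (primFun k f) (Icc 0 1) := by
  have := (primFun_ac k f).continuousOn
  rwa [uIcc_of_le zero_le_one] at this

theorem primFun_hasDerivAt (k : ℝ) (f : L2) :
    ∀ᵐ x ∂volume.restrict (Ioo (0 : ℝ) 1), HasDerivAt (primFun k f) (f x) x := by
  rw [ae_restrict_Ioo_iff]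
  filter_upwards [f.intervalIntegrable.ae_hasDerivAt_integral] with x hx hx'
  have hx'' : x ∈ uIcc (0 : ℝ) 1 := by
    rw [uIcc_of_le zero_le_one]; exact Ioo_subset_Icc_self hx'
  exact (hx hx'' 0 (by simp)).const_add k

theorem primFun_bound (k : ℝ) (f : L2) {x : ℝ} (hx : x ∈ Icc (0 : ℝ) 1) :
    |primFun k f x| ≤ |k| + ‖f‖ := by
  obtain ⟨l, hl, hl'⟩ := exists_integral_clm hx
  rw [primFun, ← hl']
  exact (abs_add_le _ _).trans (by gcongr; exact hl f)

theorem primFun_add (k k' : ℝ) (f f' : L2) {x : ℝ} (hx : x ∈ Icc (0 : ℝ) 1) :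
    primFun (k + k') (f + f') x = primFun k f x + primFun k' f' x := by
  obtain ⟨l, -, hl'⟩ := exists_integral_clm hx
  simp only [primFun, ← hl', map_add]
  ring

theorem primFun_smul (r k : ℝ) (f : L2) {x : ℝ} (hx : x ∈ Icc (0 : ℝ) 1) :
    primFun (r * k) (r • f) x = r * primFun k f x := by
  obtain ⟨l, -, hl'⟩ := exists_integral_clm hx
  simp only [primFun, ← hl', map_smul, smul_eq_mul]
  ring

theorem primFun_aestronglyMeasurable (k : ℝ) (f : L2) :
    AEStronglyMeasurable (primFun k f) (volume.restrict (Ioo (0 : ℝ) 1)) :=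
  ((primFun_continuousOn k f).mono Ioo_subset_Icc_self).aestronglyMeasurable measurableSet_Ioo

theorem primFun_memLp (k : ℝ) (f : L2) :
    MemLp (primFun k f) 2 (volume.restrict (Ioo (0 : ℝ) 1)) := by
  refine MemLp.of_bound (primFun_aestronglyMeasurable k f) (|k| + ‖f‖) ?_
  filter_upwards [ae_restrict_mem measurableSet_Ioo] with x hx
  exact primFun_bound k f (Ioo_subset_Icc_self hx)

/-- Integration by parts for a primitive against an absolutely continuous function. -/
theorem integral_primFun_mul (k : ℝ) (f : L2) {g g' : ℝ → ℝ}
    (hg : AbsolutelyContinuousOnInterval g 0 1)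
    (hg' : ∀ᵐ x ∂volume.restrict (Ioo (0 : ℝ) 1), HasDerivAt g (g' x) x) :
    ∫ x in Ioo (0 : ℝ) 1, (f x * g x + primFun k f x * g' x) =
      primFun k f 1 * g 1 - k * g 0 := by
  have h := (primFun_ac k f).integral_deriv_mul_eq_sub hg
  rw [← setIntegral_Ioo_eq, primFun_zero] at h
  rw [← h]
  refine integral_congr_ae ?_
  filter_upwards [hg', primFun_hasDerivAt k f] with x hx hx'
  rw [hx.deriv, hx'.deriv]

theorem integrable_primFun_mul (k : ℝ) (f : L2) {g : ℝ → ℝ}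
    (hg : IntegrableOn g (Ioo (0 : ℝ) 1)) :
    IntegrableOn (fun x => primFun k f x * g x) (Ioo (0 : ℝ) 1) := by
  refine Integrable.bdd_mul (c := |k| + ‖f‖) hg (primFun_aestronglyMeasurable k f) ?_
  filter_upwards [ae_restrict_mem measurableSet_Ioo] with x hx
  exact primFun_bound k f (Ioo_subset_Icc_self hx)

theorem hasWeakDeriv_prim (k : ℝ) (f : L2) :
    HasWeakDeriv ((primFun_memLp k f).toLp _) f := by
  intro φ h hc hs
  have h0 : ∀ x, x ∉ Ioo (0 : ℝ) 1 → φ x = 0 := fun x hx =>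
    image_eq_zero_of_notMem_tsupport fun hx' => hx (hs hx')
  have hac : AbsolutelyContinuousOnInterval φ 0 1 :=
    ContDiffOn.absolutelyContinuousOnInterval (h.of_le (by simp)).contDiffOn
  have h1 := integral_primFun_mul k f hac (g' := deriv φ) (Eventually.of_forall fun x =>
    (h.differentiable (by simp) x).hasDerivAt)
  rw [h0 1 (by simp), h0 0 (by simp), integral_add] at h1
  · have h2 : ∫ x in Ioo (0 : ℝ) 1, (primFun_memLp k f).toLp _ x * deriv φ x =
        ∫ x in Ioo (0 : ℝ) 1, primFun k f x * deriv φ x := by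
      refine integral_congr_ae ?_
      filter_upwards [(primFun_memLp k f).coeFn_toLp] with x hx
      rw [hx]
    rw [h2]
    linarith
  · have : MemLp φ 2 (volume.restrict (Ioo (0 : ℝ) 1)) :=
      (h.continuous.memLp_of_hasCompactSupport hc).restrict _
    exact MemLp.integrable_mul (Lp.memLp f) this
  · refine integrable_primFun_mul k f ?_
    exact ((h.continuous_deriv (by simp)).integrable_of_hasCompactSupport hc.deriv).integrableOn

theorem ae_eq_zero_of_test {h : ℝ → ℝ} (hh : IntegrableOn h (Ioo (0 : ℝ) 1))
    (H : ∀ φ : ℝ → ℝ, ContDiff ℝ ∞ φ → HasCompactSupport φ → tsupport φ ⊆ Ioo (0 : ℝ) 1 →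
      ∫ x in Ioo (0 : ℝ) 1, h x * φ x = 0) :
    ∀ᵐ x ∂volume.restrict (Ioo (0 : ℝ) 1), h x = 0 := by
  rw [ae_restrict_Ioo_iff]
  refine isOpen_Ioo.ae_eq_zero_of_integral_contDiff_smul_eq_zero hh.locallyIntegrableOn
    fun φ h1 h2 h3 => ?_
  rw [← H φ h1 h2 h3]
  have h4 : ∀ x, x ∉ Ioo (0 : ℝ) 1 → φ x • h x = 0 := fun x hx => by
    rw [image_eq_zero_of_notMem_tsupport fun hx' => hx (h3 hx'), zero_smul]
  rw [← setIntegral_eq_integral_of_forall_compl_eq_zero h4]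
  simp [mul_comm]

/-- A test function of integral zero is the derivative of a test function. -/
theorem exists_test_primitive {ξ : ℝ → ℝ} (h1 : ContDiff ℝ ∞ ξ) (h2 : HasCompactSupport ξ)
    (h3 : tsupport ξ ⊆ Ioo (0 : ℝ) 1) (h0 : ∫ x, ξ x = 0) :
    ∃ φ : ℝ → ℝ, ContDiff ℝ ∞ φ ∧ HasCompactSupport φ ∧ tsupport φ ⊆ Ioo (0 : ℝ) 1 ∧
      deriv φ = ξ := by
  obtain ⟨α, β, hαβ, hα, hβ⟩ : ∃ α β : ℝ, tsupport ξ ⊆ Icc α β ∧ 0 < α ∧ β < 1 := by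
    rcases (tsupport ξ).eq_empty_or_nonempty with he | hne
    · exact ⟨1 / 2, 1 / 2, by simp [he], by norm_num, by norm_num⟩
    · obtain ⟨α, hα⟩ := h2.isCompact.exists_isLeast hne
      obtain ⟨β, hβ⟩ := h2.isCompact.exists_isGreatest hne
      exact ⟨α, β, fun x hx => ⟨hα.2 hx, hβ.2 hx⟩, (h3 hα.1).1, (h3 hβ.1).2⟩
  have hz : ∀ x, x ∉ Icc α β → ξ x = 0 := fun x hx =>
    image_eq_zero_of_notMem_tsupport fun hx' => hx (hαβ hx')
  have hd : ∀ x, HasDerivAt (fun x => ∫ s in (0 : ℝ)..x, ξ s) (ξ x) x := fun x =>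
    (h1.continuous.integral_hasStrictDerivAt 0 x).hasDerivAt
  have hderiv : deriv (fun x => ∫ s in (0 : ℝ)..x, ξ s) = ξ := funext fun x => (hd x).deriv
  have hzero : ∀ x, x ∉ Icc α β → ∫ s in (0 : ℝ)..x, ξ s = 0 := by
    intro x hx
    by_cases hxα : x < α
    · rw [intervalIntegral.integral_congr (g := fun _ => 0), intervalIntegral.integral_zero]
      intro s hs
      refine hz s fun hs' => ?_
      have : s ≤ max 0 x := hs.2
      have := max_lt hα hxα
      linarith [hs'.1]
    · have hxβ : β < x := by
        by_contra hc
        exact hx ⟨not_lt.1 hxα, not_lt.1 hc⟩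
      have hx0 : 0 ≤ x := hα.le.trans (not_lt.1 hxα)
      rw [intervalIntegral.integral_of_le hx0]
      refine (setIntegral_eq_integral_of_forall_compl_eq_zero
        fun s hs => hz s fun hs' => hs ?_).trans h0
      exact ⟨hα.trans_le hs'.1, hs'.2.trans hxβ.le⟩
  have hsupp : tsupport (fun x => ∫ s in (0 : ℝ)..x, ξ s) ⊆ Icc α β :=
    closure_minimal (fun x hx => by
      by_contra hc
      exact hx (hzero x hc)) isClosed_Icc
  refine ⟨fun x => ∫ s in (0 : ℝ)..x, ξ s, ?_, ?_, ?_, hderiv⟩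
  · rw [contDiff_infty_iff_deriv, hderiv]
    exact ⟨fun x => (hd x).differentiableAt, h1⟩
  · exact HasCompactSupport.intro isCompact_Icc hzero
  · exact hsupp.trans fun x hx => ⟨hα.trans_le hx.1, hx.2.trans_lt hβ⟩

/-- A function orthogonal to all derivatives of test functions is constant. -/
theorem exists_ae_eq_const {h : ℝ → ℝ} (hh : IntegrableOn h (Ioo (0 : ℝ) 1))
    (H : ∀ φ : ℝ → ℝ, ContDiff ℝ ∞ φ → HasCompactSupport φ → tsupport φ ⊆ Ioo (0 : ℝ) 1 →
      ∫ x in Ioo (0 : ℝ) 1, h x * deriv φ x = 0) :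
    ∃ k : ℝ, ∀ᵐ x ∂volume.restrict (Ioo (0 : ℝ) 1), h x = k := by
  let f : ContDiffBump (1 / 2 : ℝ) := ⟨1 / 8, 1 / 4, by norm_num, by norm_num⟩
  set ψ : ℝ → ℝ := f.normed volume with hψ
  have hψ1 : ContDiff ℝ ∞ ψ := f.contDiff_normed
  have hψ2 : HasCompactSupport ψ := f.hasCompactSupport_normed
  have hψ3 : tsupport ψ ⊆ Ioo (0 : ℝ) 1 := by
    rw [hψ, f.tsupport_normed_eq, Real.closedBall_eq_Icc]
    intro x hx
    constructor
    · have := hx.1; norm_num [f] at this; linarith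
    · have := hx.2; norm_num [f] at this; linarith
  have hintegrable : ∀ {ξ : ℝ → ℝ}, Continuous ξ → HasCompactSupport ξ →
      IntegrableOn (fun x => h x * ξ x) (Ioo (0 : ℝ) 1) := fun {ξ} h1 h2 => by
    obtain ⟨C, hC⟩ := h2.exists_bound_of_continuous h1
    exact Integrable.mul_bdd hh h1.aestronglyMeasurable (Eventually.of_forall hC)
  refine ⟨∫ x in Ioo (0 : ℝ) 1, h x * ψ x, ?_⟩
  set k := ∫ x in Ioo (0 : ℝ) 1, h x * ψ x with hk
  have hmain : ∀ᵐ x ∂volume.restrict (Ioo (0 : ℝ) 1), h x - k = 0 := by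
    refine ae_eq_zero_of_test (hh.sub (integrableOn_const (by simp))) fun ξ h1 h2 h3 => ?_
    obtain ⟨φ, hφ1, hφ2, hφ3, hφ4⟩ := exists_test_primitive (ξ := fun x => ξ x - (∫ y, ξ y) * ψ x)
      (h1.sub (contDiff_const.mul hψ1)) (h2.sub (hψ2.mul_left)) (by
        refine (tsupport_sub _ _).trans (union_subset h3 ?_)
        exact (closure_mono (Function.support_mul_subset_right _ _)).trans hψ3) (by
        rw [integral_sub (h1.continuous.integrable_of_hasCompactSupport h2)
          ((hψ1.continuous.integrable_of_hasCompactSupport hψ2).const_mul _),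
          integral_const_mul, f.integral_normed, mul_one, sub_self])
    have h5 := H φ hφ1 hφ2 hφ3
    simp only [hφ4] at h5
    have e1 : ∀ x, h x * (ξ x - (∫ y, ξ y) * ψ x) = h x * ξ x - (∫ y, ξ y) * (h x * ψ x) :=
      fun x => by ring
    simp only [e1] at h5
    rw [integral_sub (hintegrable h1.continuous h2) ((hintegrable hψ1.continuous hψ2).const_mul _),
      integral_const_mul] at h5
    have e2 : ∀ x, (h x - k) * ξ x = h x * ξ x - k * ξ x := fun x => by ring
    simp only [e2]
    rw [integral_sub (hintegrable h1.continuous h2)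
      ((h1.continuous.integrable_of_hasCompactSupport h2).integrableOn.const_mul _),
      integral_const_mul]
    have e3 : ∫ x in Ioo (0 : ℝ) 1, ξ x = ∫ x, ξ x :=
      setIntegral_eq_integral_of_forall_compl_eq_zero fun x hx =>
        image_eq_zero_of_notMem_tsupport fun hx' => hx (h3 hx')
    rw [e3]
    linarith
  filter_upwards [hmain] with x hx
  linarith

theorem H1.ext' {w w' : H1} (h1 : w.fn = w'.fn) (h2 : w.dx = w'.dx) : w = w' :=
  Subtype.ext ((WithLp.equiv 2 (L2 × L2)).injective (Prod.ext h1 h2))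

theorem H1.exists_primFun (w : H1) : ∃ k : ℝ,
    (w.fn : ℝ → ℝ) =ᵐ[volume.restrict (Ioo (0 : ℝ) 1)] primFun k w.dx := by
  have hintegrable : IntegrableOn (fun x => w.fn x - primFun 0 w.dx x) (Ioo (0 : ℝ) 1) :=
    w.fn.integrable.sub ((primFun_memLp 0 w.dx).integrable one_le_two)
  obtain ⟨k, hk⟩ := exists_ae_eq_const hintegrable fun φ h hc hs => by
    have h1 : ∫ x in Ioo (0 : ℝ) 1, w.fn x * deriv φ x = _ := w.2 φ h hc hs
    have h2 := hasWeakDeriv_prim 0 w.dx φ h hc hs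
    have h3 : ∫ x in Ioo (0 : ℝ) 1, (primFun_memLp 0 w.dx).toLp _ x * deriv φ x =
        ∫ x in Ioo (0 : ℝ) 1, primFun 0 w.dx x * deriv φ x := by
      refine integral_congr_ae ?_
      filter_upwards [(primFun_memLp 0 w.dx).coeFn_toLp] with x hx
      rw [hx]
    have hd : MemLp (deriv φ) 2 (volume.restrict (Ioo (0 : ℝ) 1)) :=
      ((h.continuous_deriv (by simp)).memLp_of_hasCompactSupport hc.deriv).restrict _
    have e : ∀ x, (w.fn x - primFun 0 w.dx x) * deriv φ x =
      w.fn x * deriv φ x - primFun 0 w.dx x * deriv φ x := fun x => by ring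
    simp only [e]
    have i1 : Integrable (fun x => w.fn x * deriv φ x) (volume.restrict (Ioo (0 : ℝ) 1)) :=
      MemLp.integrable_mul (Lp.memLp w.fn) hd
    have i2 : Integrable (fun x => primFun 0 w.dx x * deriv φ x)
      (volume.restrict (Ioo (0 : ℝ) 1)) := MemLp.integrable_mul (primFun_memLp 0 w.dx) hd
    rw [integral_sub i1 i2, ← h3, h2, h1]
    exact sub_self _
  refine ⟨k, ?_⟩
  filter_upwards [hk] with x hx
  simp only [primFun] at hx ⊢
  linarith

theorem eqOn_of_ae_eq_Ioo {f g : ℝ → ℝ} (hf : ContinuousOn f (Icc 0 1))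
    (hg : ContinuousOn g (Icc 0 1)) (h : f =ᵐ[volume.restrict (Ioo (0 : ℝ) 1)] g) :
    EqOn f g (Icc 0 1) := by
  refine Measure.eqOn_Icc_of_ae_eq (μ := volume) zero_ne_one ?_ hf hg
  rwa [← Measure.restrict_congr_set (Ioo_ae_eq_Icc (μ := volume) (a := (0 : ℝ)) (b := 1))]

theorem H1.val_spec (w : H1) : ContinuousOn w.val (Icc (0 : ℝ) 1) ∧
    (w.fn : ℝ → ℝ) =ᵐ[volume.restrict (Ioo (0 : ℝ) 1)] w.val := by
  obtain ⟨k, hk⟩ := w.exists_primFun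
  exact Classical.epsilon_spec (p := fun g : ℝ → ℝ => ContinuousOn g (Icc (0 : ℝ) 1) ∧
    (w.fn : ℝ → ℝ) =ᵐ[volume.restrict (Ioo (0 : ℝ) 1)] g) ⟨_, primFun_continuousOn k w.dx, hk⟩

theorem H1.val_eq_primFun (w : H1) {x : ℝ} (hx : x ∈ Icc (0 : ℝ) 1) :
    w.val x = primFun (w.val 0) w.dx x := by
  obtain ⟨k, hk⟩ := w.exists_primFun
  have h := eqOn_of_ae_eq_Ioo w.val_spec.1 (primFun_continuousOn k w.dx)
    (w.val_spec.2.symm.trans hk)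
  have h0 := h (left_mem_Icc.2 zero_le_one)
  rw [primFun_zero] at h0
  rw [h hx, h0]

theorem H1.fn_ae_eq (w : H1) :
    (w.fn : ℝ → ℝ) =ᵐ[volume.restrict (Ioo (0 : ℝ) 1)] primFun (w.val 0) w.dx := by
  filter_upwards [w.val_spec.2, ae_restrict_mem measurableSet_Ioo] with x hx hx'
  rw [hx, w.val_eq_primFun (Ioo_subset_Icc_self hx')]

/-- The primitive `x ↦ k + ∫₀ˣ f` as an element of `H¹(0,1)`. -/
def mkH1 (k : ℝ) (f : L2) : H1 := ⟨WithLp.toLp 2 ((primFun_memLp k f).toLp _, f),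
  hasWeakDeriv_prim k f⟩

@[simp] theorem mkH1_dx (k : ℝ) (f : L2) : (mkH1 k f).dx = f := rfl

theorem mkH1_fn (k : ℝ) (f : L2) :
    ((mkH1 k f).fn : ℝ → ℝ) =ᵐ[volume.restrict (Ioo (0 : ℝ) 1)] primFun k f :=
  (primFun_memLp k f).coeFn_toLp

theorem mkH1_val (k : ℝ) (f : L2) {x : ℝ} (hx : x ∈ Icc (0 : ℝ) 1) :
    (mkH1 k f).val x = primFun k f x :=
  eqOn_of_ae_eq_Ioo (mkH1 k f).val_spec.1 (primFun_continuousOn k f)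
    ((mkH1 k f).val_spec.2.symm.trans (mkH1_fn k f)) hx

@[simp] theorem mkH1_val_zero (k : ℝ) (f : L2) : (mkH1 k f).val 0 = k := by
  rw [mkH1_val k f (left_mem_Icc.2 zero_le_one), primFun_zero]

theorem H1.eq_mkH1 (w : H1) : w = mkH1 (w.val 0) w.dx :=
  H1.ext' (Lp.ext (w.fn_ae_eq.trans (mkH1_fn _ _).symm)) rfl

theorem H1.ext_val {w w' : H1} (h1 : w.val 0 = w'.val 0) (h2 : w.dx = w'.dx) : w = w' := by
  rw [w.eq_mkH1, w'.eq_mkH1, h1, h2]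

theorem H1.dx_eq_zero {w : H1} (h : w.fn = 0) : w.dx = 0 := by
  have h1 : ∀ᵐ x ∂volume.restrict (Ioo (0 : ℝ) 1), w.dx x = 0 := by
    refine ae_eq_zero_of_test w.dx.integrable fun φ h1 h2 h3 => ?_
    have h4 : ∫ x in Ioo (0 : ℝ) 1, w.fn x * deriv φ x = - ∫ x in Ioo (0 : ℝ) 1, w.dx x * φ x :=
      w.2 φ h1 h2 h3
    have h5 : ∫ x in Ioo (0 : ℝ) 1, w.fn x * deriv φ x = 0 := by
      rw [h]
      refine integral_eq_zero_of_ae ?_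
      filter_upwards [Lp.coeFn_zero ℝ 2 (volume.restrict (Ioo (0 : ℝ) 1))] with x hx
      simp
    linarith
  refine Lp.ext ?_
  filter_upwards [h1, Lp.coeFn_zero ℝ 2 (volume.restrict (Ioo (0 : ℝ) 1))] with x hx hx'
  rw [hx, hx']; rfl

/-! ### Continuous linear maps between `H¹(0,1)` and `L²(0,1)` -/

/-- The inclusion of `H¹(0,1)` into `L²(0,1)`. -/
def fnL : H1 →L[ℝ] L2 := WithLp.fstL 2 ℝ L2 L2 ∘L weakGraph.subtypeL

/-- The weak derivative as a continuous linear map. -/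
def dxL : H1 →L[ℝ] L2 := WithLp.sndL 2 ℝ L2 L2 ∘L weakGraph.subtypeL

@[simp] theorem fnL_apply (w : H1) : fnL w = w.fn := rfl

theorem H1.norm_sq_eq (w : H1) : ‖w‖ ^ 2 = ‖w.fn‖ ^ 2 + ‖w.dx‖ ^ 2 :=
  WithLp.prod_norm_sq_eq_of_L2 w.1

theorem mkH1_norm_fn_le (k : ℝ) (f : L2) : ‖(mkH1 k f).fn‖ ≤ |k| + ‖f‖ := by
  refine (Lp.norm_le_of_ae_bound (C := |k| + ‖f‖) (by positivity) ?_).trans ?_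
  · filter_upwards [mkH1_fn k f, ae_restrict_mem measurableSet_Ioo] with x hx hx'
    rw [hx]
    exact primFun_bound k f (Ioo_subset_Icc_self hx')
  · simp [measureUnivNNReal]

theorem mkH1_norm_le (k : ℝ) (f : L2) : ‖mkH1 k f‖ ≤ 2 * (|k| + ‖f‖) := by
  have h1 := mkH1_norm_fn_le k f
  have h2 := (mkH1 k f).norm_sq_eq
  rw [mkH1_dx] at h2
  have h3 := abs_nonneg k
  have h4 := norm_nonneg f
  refine abs_le_of_sq_le_sq' ?_ (by positivity) |>.2
  nlinarith [norm_nonneg (mkH1 k f).fn]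

/-- The primitive as a continuous linear map. -/
def primL : ℝ × L2 →L[ℝ] H1 :=
  LinearMap.mkContinuous
    { toFun := fun q => mkH1 q.1 q.2
      map_add' := fun q q' => by
        refine H1.ext' (Lp.ext ?_) rfl
        have h1 : ((mkH1 q.1 q.2 + mkH1 q'.1 q'.2 : H1).fn : ℝ → ℝ)
            =ᵐ[volume.restrict (Ioo (0 : ℝ) 1)] _ :=
          Lp.coeFn_add (mkH1 q.1 q.2).fn (mkH1 q'.1 q'.2).fn
        filter_upwards [h1, mkH1_fn q.1 q.2, mkH1_fn q'.1 q'.2, mkH1_fn (q + q').1 (q + q').2,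
          ae_restrict_mem measurableSet_Ioo] with x h1 h2 h3 h4 h5
        rw [h1, h4, Pi.add_apply, h2, h3]
        exact primFun_add _ _ _ _ (Ioo_subset_Icc_self h5)
      map_smul' := fun r q => by
        refine H1.ext' (Lp.ext ?_) rfl
        have h1 : ((r • mkH1 q.1 q.2 : H1).fn : ℝ → ℝ)
            =ᵐ[volume.restrict (Ioo (0 : ℝ) 1)] _ := Lp.coeFn_smul r (mkH1 q.1 q.2).fn
        filter_upwards [h1, mkH1_fn q.1 q.2, mkH1_fn (r • q).1 (r • q).2,
          ae_restrict_mem measurableSet_Ioo] with x h1 h2 h4 h5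
        simp only [RingHom.id_apply]
        rw [h1, h4, Pi.smul_apply, h2]
        exact primFun_smul _ _ _ (Ioo_subset_Icc_self h5) }
    4 fun q => by
      refine (mkH1_norm_le _ _).trans ?_
      have h1 : |q.1| ≤ ‖q‖ := norm_fst_le q
      have h2 := norm_snd_le q
      linarith

/-- Integration by parts in `H¹(0,1)` with a smooth weight. -/
theorem H1.integral_by_parts (v w : H1) {e : ℝ → ℝ} (he : ContDiff ℝ 1 e) :
    ∫ x in Ioo (0 : ℝ) 1, (e x * (v.dx x * w.fn x) + e x * (v.fn x * w.dx x) +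
      deriv e x * (v.fn x * w.fn x)) = e 1 * (v.val 1 * w.val 1) - e 0 * (v.val 0 * w.val 0) := by
  have hac : AbsolutelyContinuousOnInterval e 0 1 :=
    ContDiffOn.absolutelyContinuousOnInterval he.contDiffOn
  have h1 := integral_primFun_mul (v.val 0) v.dx (g := fun x => e x * primFun (w.val 0) w.dx x)
    (g' := fun x => deriv e x * primFun (w.val 0) w.dx x + e x * w.dx x)
    (hac.mul (primFun_ac _ _)) (by
      filter_upwards [primFun_hasDerivAt (w.val 0) w.dx] with x hx
      exact (he.differentiable one_ne_zero x).hasDerivAt.mul hx)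
  rw [← v.val_eq_primFun (right_mem_Icc.2 zero_le_one),
    ← w.val_eq_primFun (right_mem_Icc.2 zero_le_one), primFun_zero] at h1
  have h2 : e 1 * (v.val 1 * w.val 1) - e 0 * (v.val 0 * w.val 0) =
    v.val 1 * (e 1 * w.val 1) - v.val 0 * (e 0 * w.val 0) := by ring
  rw [h2, ← h1]
  refine integral_congr_ae ?_
  filter_upwards [v.fn_ae_eq, w.fn_ae_eq] with x hx hx'
  rw [hx, hx']
  ring

/-- The constant function `1` in `H¹(0,1)`. -/
def oneH : H1 := mkH1 1 0

theorem oneH_fn : ∀ᵐ x ∂volume.restrict (Ioo (0 : ℝ) 1), oneH.fn x = 1 := by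
  filter_upwards [mkH1_fn 1 0, ae_restrict_mem measurableSet_Ioo] with x hx hx'
  rw [oneH, hx]
  obtain ⟨l, -, hl'⟩ := exists_integral_clm (Ioo_subset_Icc_self hx')
  rw [primFun, ← hl', map_zero, add_zero]

/-- The pairing `∫ f g` on `L²(0,1)`. -/
def pairL : L2 →L[ℝ] L2 →L[ℝ] ℝ :=
  (ContinuousLinearMap.mul ℝ ℝ).lpPairing (volume.restrict (Ioo (0 : ℝ) 1)) 2 2

theorem pairL_apply (f g : L2) : pairL f g = ∫ x in Ioo (0 : ℝ) 1, f x * g x :=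
  ContinuousLinearMap.lpPairing_eq_integral _ _ _

theorem pairL_comm (f g : L2) : pairL f g = pairL g f := by
  simp only [pairL_apply, mul_comm]

theorem pairL_self (f : L2) : pairL f f = ‖f‖ ^ 2 := by
  rw [pairL_apply, L2.norm_sq_eq]
  simp only [sq]

/-- The functional `f ↦ ∫₀¹ f`. -/
def intL : L2 →L[ℝ] ℝ := pairL oneH.fn

theorem intL_apply (f : L2) : intL f = ∫ x in (0 : ℝ)..1, f x := by
  rw [intL, pairL_apply, ← setIntegral_Ioo_eq]
  refine integral_congr_ae ?_
  filter_upwards [oneH_fn] with x hx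
  rw [hx, one_mul]

theorem abs_intL_le (f : L2) : |intL f| ≤ ‖f‖ := by
  obtain ⟨l, hl, hl'⟩ := exists_integral_clm (right_mem_Icc.2 (zero_le_one (α := ℝ)))
  rw [intL_apply, ← hl']
  exact hl f

theorem H1.val_one_eq (w : H1) : w.val 1 = w.val 0 + intL w.dx := by
  rw [w.val_eq_primFun (right_mem_Icc.2 zero_le_one), intL_apply, primFun]

theorem mkH1_val_one (k : ℝ) (f : L2) : (mkH1 k f).val 1 = k + intL f := by
  rw [H1.val_one_eq, mkH1_val_zero, mkH1_dx]

/-- The value at `0` as a continuous functional. -/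
def val0L : H1 →L[ℝ] ℝ := pairL oneH.fn ∘L fnL + pairL (mkH1 0 oneH.fn).fn ∘L dxL - intL ∘L dxL

theorem val0L_apply (w : H1) : val0L w = w.val 0 := by
  have h := (mkH1 0 oneH.fn).integral_by_parts w (e := fun _ => 1) contDiff_const
  have h1 : (mkH1 0 oneH.fn).val 1 = 1 := by
    rw [mkH1_val_one, intL, pairL_apply, zero_add]
    have : ∫ x in Ioo (0 : ℝ) 1, oneH.fn x * oneH.fn x = ∫ x in Ioo (0 : ℝ) 1, (1 : ℝ) := by
      refine integral_congr_ae ?_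
      filter_upwards [oneH_fn] with x hx
      rw [hx, one_mul]
    rw [this]
    simp
  rw [h1, mkH1_val_zero, w.val_one_eq] at h
  simp only [one_mul, deriv_const, zero_mul, add_zero, mul_zero, sub_zero, mkH1_dx] at h
  rw [integral_add (L2.integrable_mul _ _) (L2.integrable_mul _ _), ← pairL_apply,
    ← pairL_apply] at h
  change pairL oneH.fn w.fn + pairL (mkH1 0 oneH.fn).fn w.dx - intL w.dx = _
  linarith

theorem H1.val_add_zero (v w : H1) : (v + w).val 0 = v.val 0 + w.val 0 := by
  simp only [← val0L_apply, map_add]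

theorem H1.val_sub_zero (v w : H1) : (v - w).val 0 = v.val 0 - w.val 0 := by
  simp only [← val0L_apply, map_sub]

theorem H1.val_smul_zero (r : ℝ) (w : H1) : (r • w).val 0 = r * w.val 0 := by
  simp only [← val0L_apply, map_smul, smul_eq_mul]

theorem H1.dx_add (v w : H1) : (v + w).dx = v.dx + w.dx := rfl

theorem H1.dx_sub (v w : H1) : (v - w).dx = v.dx - w.dx := rfl

theorem H1.dx_smul (r : ℝ) (w : H1) : (r • w).dx = r • w.dx := rfl

theorem H1.fn_add (v w : H1) : (v + w).fn = v.fn + w.fn := rfl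

theorem H1.fn_sub (v w : H1) : (v - w).fn = v.fn - w.fn := rfl

theorem H1.fn_smul (r : ℝ) (w : H1) : (r • w).fn = r • w.fn := rfl

theorem H1.val_add_one (v w : H1) : (v + w).val 1 = v.val 1 + w.val 1 := by
  rw [H1.val_one_eq, H1.val_add_zero, H1.dx_add, map_add, v.val_one_eq, w.val_one_eq]; ring

theorem H1.val_sub_one (v w : H1) : (v - w).val 1 = v.val 1 - w.val 1 := by
  rw [H1.val_one_eq, H1.val_sub_zero, H1.dx_sub, map_sub, v.val_one_eq, w.val_one_eq]; ring

theorem H1.val_smul_one (r : ℝ) (w : H1) : (r • w).val 1 = r * w.val 1 := by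
  rw [H1.val_one_eq, H1.val_smul_zero, H1.dx_smul, map_smul, w.val_one_eq, smul_eq_mul]; ring

theorem H1.norm_fn_le (w : H1) : ‖w.fn‖ ≤ |w.val 0| + ‖w.dx‖ := by
  have := mkH1_norm_fn_le (w.val 0) w.dx
  rwa [← w.eq_mkH1] at this

theorem exp_memLp (s : ℝ) :
    MemLp (fun x => Real.exp (s * x)) ⊤ (volume.restrict (Ioo (0 : ℝ) 1)) := by
  refine memLp_top_of_bound (by fun_prop) (Real.exp |s|) ?_
  filter_upwards [ae_restrict_mem measurableSet_Ioo] with x hx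
  rw [Real.norm_of_nonneg (Real.exp_pos _).le, Real.exp_le_exp]
  have := abs_nonneg s
  have := le_abs_self s
  nlinarith [hx.1, hx.2]

/-- Multiplication by `x ↦ exp (s x)` on `L²(0,1)`. -/
def expMul (s : ℝ) : L2 →L[ℝ] L2 :=
  (ContinuousLinearMap.mul ℝ ℝ).holderL (volume.restrict (Ioo (0 : ℝ) 1)) ⊤ 2 2
    ((exp_memLp s).toLp _)

/-- The weighted pairing `∫ exp (s x) f g`. -/
def expForm (s : ℝ) : L2 →L[ℝ] L2 →L[ℝ] ℝ := pairL ∘L expMul s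

theorem expForm_apply (s : ℝ) (f g : L2) :
    expForm s f g = ∫ x in Ioo (0 : ℝ) 1, Real.exp (s * x) * (f x * g x) := by
  change pairL (expMul s f) g = _
  rw [pairL_apply]
  refine integral_congr_ae ?_
  have h1 : (expMul s f : ℝ → ℝ) =ᵐ[volume.restrict (Ioo (0 : ℝ) 1)] _ :=
    ContinuousLinearMap.coeFn_holder (r := 2) (ContinuousLinearMap.mul ℝ ℝ)
      ((exp_memLp s).toLp _) f
  filter_upwards [h1, (exp_memLp s).coeFn_toLp] with x hx hx'
  rw [hx, hx', ContinuousLinearMap.mul_apply', mul_assoc]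

theorem expForm_integrable (s : ℝ) (f g : L2) : Integrable
    (fun x => Real.exp (s * x) * (f x * g x)) (volume.restrict (Ioo (0 : ℝ) 1)) := by
  refine Integrable.bdd_mul (c := Real.exp |s|) (L2.integrable_mul f g) (by fun_prop) ?_
  filter_upwards [ae_restrict_mem measurableSet_Ioo] with x hx
  rw [Real.norm_of_nonneg (Real.exp_pos _).le, Real.exp_le_exp]
  have := abs_nonneg s
  have := le_abs_self s
  nlinarith [hx.1, hx.2]

theorem expForm_comm (s : ℝ) (f g : L2) : expForm s f g = expForm s g f := by
  simp only [expForm_apply, mul_comm (f _)]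

theorem two_mul_expForm_dx (s : ℝ) (w : H1) : 2 * expForm s w.fn w.dx =
    Real.exp s * w.val 1 ^ 2 - w.val 0 ^ 2 - s * expForm s w.fn w.fn := by
  have he : ContDiff ℝ 1 fun x : ℝ => Real.exp (s * x) := by fun_prop
  have hd : ∀ x, deriv (fun x : ℝ => Real.exp (s * x)) x = s * Real.exp (s * x) := fun x => by
    have : HasDerivAt (fun x : ℝ => Real.exp (s * x)) (Real.exp (s * x) * (s * 1)) x :=
      ((hasDerivAt_id x).const_mul s).exp
    rw [this.deriv]; ring
  have h := w.integral_by_parts w he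
  simp only [hd, mul_assoc s, mul_one, mul_zero, Real.exp_zero, one_mul] at h
  rw [integral_add ((expForm_integrable s _ _).fun_add (expForm_integrable s _ _))
      ((expForm_integrable s _ _).const_mul s),
    integral_add (expForm_integrable s _ _) (expForm_integrable s _ _), integral_const_mul,
    ← expForm_apply, ← expForm_apply, ← expForm_apply, expForm_comm s w.dx] at h
  linarith

theorem pairL_by_parts (v w : H1) :
    pairL v.dx w.fn + pairL v.fn w.dx = v.val 1 * w.val 1 - v.val 0 * w.val 0 := by
  have h := v.integral_by_parts w (e := fun _ => 1) contDiff_const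
  simp only [one_mul, deriv_const, zero_mul, add_zero] at h
  rwa [integral_add (L2.integrable_mul _ _) (L2.integrable_mul _ _), ← pairL_apply,
    ← pairL_apply] at h

theorem le_expForm_self {s r : ℝ} (h : ∀ x ∈ Ioo (0 : ℝ) 1, r ≤ Real.exp (s * x)) (f : L2) :
    r * ‖f‖ ^ 2 ≤ expForm s f f := by
  rw [L2.norm_sq_eq, expForm_apply, ← integral_const_mul]
  refine integral_mono_ae ?_ (expForm_integrable s f f) ?_
  · simp only [sq]
    exact (L2.integrable_mul f f).const_mul r
  · filter_upwards [ae_restrict_mem measurableSet_Ioo] with x hx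
    simp only [← sq]
    exact mul_le_mul_of_nonneg_right (h x hx) (sq_nonneg _)

theorem norm_sq_le_expForm (μ : ℝ) (f v : L2) : ‖f‖ ^ 2 ≤
    Real.cosh μ / 2 * (expForm μ (v + f) (v + f) + expForm (-μ) (v - f) (v - f)) := by
  rw [L2.norm_sq_eq, expForm_apply, expForm_apply, ← integral_add (expForm_integrable _ _ _)
    (expForm_integrable _ _ _), ← integral_const_mul]
  refine integral_mono_ae ?_ (((expForm_integrable _ _ _).fun_add
    (expForm_integrable _ _ _)).const_mul _) ?_
  · simp only [sq]
    exact L2.integrable_mul f f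
  · filter_upwards [ae_restrict_mem measurableSet_Ioo, Lp.coeFn_add v f, Lp.coeFn_sub v f]
      with x hx h1 h2
    rw [h1, h2, Pi.add_apply, Pi.sub_apply]
    have hc : Real.cosh (μ * x) ≤ Real.cosh μ := by
      rw [Real.cosh_le_cosh, abs_mul, abs_of_pos hx.1]
      exact mul_le_of_le_one_right (abs_nonneg μ) hx.2.le
    have hE : Real.exp (μ * x) * Real.exp (-μ * x) = 1 := by
      rw [← Real.exp_add]; simp
    have hE1 := Real.exp_pos (μ * x)
    have hE2 := Real.exp_pos (-μ * x)
    have hc' : Real.cosh (μ * x) = (Real.exp (μ * x) + Real.exp (-μ * x)) / 2 := by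
      rw [Real.cosh_eq, neg_mul]
    set E := Real.exp (μ * x)
    set E' := Real.exp (-μ * x)
    have h3 : f x ^ 2 ≤ Real.cosh (μ * x) / 2 *
        (E * ((v x + f x) * (v x + f x)) + E' * ((v x - f x) * (v x - f x))) := by
      rw [hc']
      have h4 := sq_nonneg (E * (v x + f x) + E' * (v x - f x))
      have h5 : (E + E') * (E * ((v x + f x) * (v x + f x)) + E' * ((v x - f x) * (v x - f x))) =
        (E * (v x + f x) + E' * (v x - f x)) ^ 2 + E * E' * (4 * f x ^ 2) := by ring
      rw [hE] at h5
      linarith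
    refine h3.trans (mul_le_mul_of_nonneg_right (by linarith) ?_)
    have := mul_self_nonneg (v x + f x)
    have := mul_self_nonneg (v x - f x)
    positivity

/-! ### The energy form and the inverse of the generator -/

/-- The wave part of the energy form, in the coordinates `(u_x, u_t)`. -/
def waveForm (μ : ℝ) (f v f' v' : L2) : ℝ :=
  expForm μ (v + f) (v' + f') + expForm (-μ) (v - f) (v' - f')

theorem add_sq_le_young {θ : ℝ} (hθ : 0 < θ) (x y : ℝ) :
    (x + y) ^ 2 ≤ (1 + θ) * y ^ 2 + (1 + 1 / θ) * x ^ 2 := by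
  rw [← sub_nonneg]
  have e : (1 + θ) * y ^ 2 + (1 + 1 / θ) * x ^ 2 - (x + y) ^ 2 = (θ * y - x) ^ 2 / θ := by
    field_simp
    ring
  rw [e]
  positivity

theorem neg_two_mul_le_young {κ₀ d v R S N : ℝ} (hκ : 0 < κ₀) (h : R ^ 2 ≤ S * N) :
    -2 * (d * v * R) ≤ κ₀ * v ^ 2 + d ^ 2 * N / κ₀ * S := by
  have e1 : d ^ 2 * R ^ 2 / κ₀ ≤ d ^ 2 * N / κ₀ * S := by
    rw [div_mul_eq_mul_div]
    refine div_le_div_of_nonneg_right ?_ hκ.le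
    linarith [mul_le_mul_of_nonneg_left h (sq_nonneg d)]
  have e2 : κ₀ * v ^ 2 + 2 * (d * v * R) + d ^ 2 * R ^ 2 / κ₀ = (κ₀ * v + d * R) ^ 2 / κ₀ := by
    field_simp
    ring
  have e3 : 0 ≤ (κ₀ * v + d * R) ^ 2 / κ₀ := by positivity
  linarith

theorem exists_young_constant {μ : ℝ} (hμ : 0 < μ) :
    ∃ θ : ℝ, 0 < θ ∧ (1 + θ) * (μ * Real.exp (-μ) * (Real.cosh μ / 2)) = μ / 2 := by
  have hrpos : 0 < μ * Real.exp (-μ) * (Real.cosh μ / 2) := by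
    have := Real.cosh_pos μ
    have := Real.exp_pos (-μ)
    positivity
  have hrlt : μ * Real.exp (-μ) * (Real.cosh μ / 2) < μ / 2 := by
    have e1 : Real.exp (-μ) * Real.exp μ = 1 := by rw [← Real.exp_add]; simp
    have e2 : Real.exp (-μ) * Real.exp (-μ) < 1 := by
      rw [← Real.exp_add, Real.exp_lt_one_iff]; linarith
    have e3 : μ * Real.exp (-μ) * (Real.cosh μ / 2) =
        μ / 4 * (Real.exp (-μ) * Real.exp μ + Real.exp (-μ) * Real.exp (-μ)) := by
      rw [Real.cosh_eq]; ring
    rw [e3, e1]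
    nlinarith
  set r := μ * Real.exp (-μ) * (Real.cosh μ / 2)
  refine ⟨μ / (2 * r) - 1, ?_, by field_simp; ring⟩
  rw [sub_pos, lt_div_iff₀ (by positivity)]
  linarith

theorem waveForm_generator {μ a q : ℝ} {ux v : H1} (hv : v.val 0 = 0)
    (h1 : ux.val 1 = -a * v.val 1 + q) :
    2 * waveForm μ ux.fn v.fn v.dx ux.dx = -μ * waveForm μ ux.fn v.fn ux.fn v.fn +
      (Real.exp μ * ((1 - a) * v.val 1 + q) ^ 2 - Real.exp (-μ) * ((1 + a) * v.val 1 - q) ^ 2) := by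
  have e1 := two_mul_expForm_dx μ (v + ux)
  have e2 := two_mul_expForm_dx (-μ) (v - ux)
  rw [H1.val_add_zero, H1.val_add_one, H1.dx_add, H1.fn_add, hv, h1] at e1
  rw [H1.val_sub_zero, H1.val_sub_one, H1.dx_sub, H1.fn_sub, hv, h1] at e2
  have e3 : ux.dx - v.dx = -(v.dx - ux.dx) := by abel
  rw [waveForm, waveForm, add_comm ux.dx, e3, map_neg]
  linear_combination e1 - e2

theorem boundary_le {μ a : ℝ} (hμ : 2 * Real.exp μ ^ 2 * (1 - a) ^ 2 ≤ (1 + a) ^ 2) (v q : ℝ) :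
    Real.exp μ * ((1 - a) * v + q) ^ 2 - Real.exp (-μ) * ((1 + a) * v - q) ^ 2 ≤
      -(Real.exp (-μ) * (1 + a) ^ 2 / 5) * v ^ 2 + F μ * q ^ 2 := by
  have hF : F μ = 6 * Real.exp μ + 4 * Real.exp (-μ) := by
    rw [F, Real.sinh_eq, Real.cosh_eq]; ring
  have hE : Real.exp μ * Real.exp (-μ) = 1 := by rw [← Real.exp_add]; simp
  have hE1 := Real.exp_pos μ
  have hE2 := Real.exp_pos (-μ)
  rw [hF]
  set E := Real.exp μ
  set E' := Real.exp (-μ)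
  have h1 : 2 * E * (1 - a) ^ 2 ≤ E' * (1 + a) ^ 2 := by
    calc 2 * E * (1 - a) ^ 2 = E' * (2 * E ^ 2 * (1 - a) ^ 2) := by
          linear_combination (-2 * E * (1 - a) ^ 2) * hE
      _ ≤ _ := mul_le_mul_of_nonneg_left hμ hE2.le
  have h2 : ((1 - a) * v + q) ^ 2 ≤ 6 / 5 * (1 - a) ^ 2 * v ^ 2 + 6 * q ^ 2 := by
    nlinarith [sq_nonneg ((1 - a) * v - 5 * q)]
  have h3 : 4 / 5 * (1 + a) ^ 2 * v ^ 2 - 4 * q ^ 2 ≤ ((1 + a) * v - q) ^ 2 := by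
    nlinarith [sq_nonneg ((1 + a) * v - 5 * q)]
  have h4 := mul_le_mul_of_nonneg_left h2 hE1.le
  have h5 := mul_le_mul_of_nonneg_left h3 hE2.le
  have h6 := mul_le_mul_of_nonneg_right h1 (sq_nonneg v)
  linarith

theorem waveForm_ge (μ : ℝ) (hμ : 0 ≤ μ) (f v : L2) :
    2 * Real.exp (-μ) * (‖f‖ ^ 2 + ‖v‖ ^ 2) ≤ waveForm μ f v f v := by
  have h1 := le_expForm_self (s := μ) (r := Real.exp (-μ)) (fun x hx =>
    Real.exp_le_exp.2 (by nlinarith [hx.1])) (v + f)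
  have h2 := le_expForm_self (s := -μ) (r := Real.exp (-μ)) (fun x hx =>
    Real.exp_le_exp.2 (by nlinarith [hx.2])) (v - f)
  have h3 := parallelogram_law_with_norm ℝ v f
  rw [waveForm]
  have h4 : ‖v + f‖ ^ 2 + ‖v - f‖ ^ 2 = 2 * (‖f‖ ^ 2 + ‖v‖ ^ 2) := by linarith [h3]
  have h5 : Real.exp (-μ) * (‖v + f‖ ^ 2 + ‖v - f‖ ^ 2) = 2 * Real.exp (-μ) * (‖f‖ ^ 2 + ‖v‖ ^ 2)
    := by rw [h4]; ring
  linarith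

/-- The data of the heat component: a space `E` between `H¹` and `L²` with an equivalent inner
product for which the Laplacian with the boundary conditions `p_x(0) = c p(0)`, `p_x(1) = 0` is
strictly dissipative. -/
structure IsHeatSpace {E : Type*} [NormedAddCommGroup E] [NormedSpace ℝ E] (ι : E →L[ℝ] L2)
    (κ : H1 →L[ℝ] E) (BE : E →L[ℝ] E →L[ℝ] ℝ) (c m k : ℝ) : Prop where
  comp : ∀ w, ι (κ w) = w.fn
  inj : ∀ e, ι e = 0 → e = 0
  form : IsEnergyForm BE m
  pos : 0 < k
  diss : ∀ (p px : H1) (s : E), px.fn = p.dx → px.val 0 = c * p.val 0 → px.val 1 = 0 →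
    ι s = px.dx → BE (κ p) s ≤ -k * (p.val 0 ^ 2 + BE (κ p) (κ p))

section Generator

variable {E : Type*} [NormedAddCommGroup E] [NormedSpace ℝ E] (ι : E →L[ℝ] L2)
    (κ : H1 →L[ℝ] E) (BE : E →L[ℝ] E →L[ℝ] ℝ)

/-- The profile `x + 1/c` of the stationary heat equation. -/
def profile (c : ℝ) : H1 := mkH1 (1 / c) oneH.fn

/-- The coordinate `u_x`. -/
abbrev gradL : L2 × L2 × E →L[ℝ] L2 := ContinuousLinearMap.fst ℝ L2 (L2 × E)

/-- The coordinate `u_t`. -/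
abbrev velL : L2 × L2 × E →L[ℝ] L2 :=
  ContinuousLinearMap.fst ℝ L2 E ∘L ContinuousLinearMap.snd ℝ L2 (L2 × E)

/-- The coordinate `p`. -/
abbrev heatL : L2 × L2 × E →L[ℝ] E :=
  ContinuousLinearMap.snd ℝ L2 E ∘L ContinuousLinearMap.snd ℝ L2 (L2 × E)

/-- The deviation `p - d u(1) (x + 1/c)` of the heat component from its equilibrium. -/
def devL (c d : ℝ) : L2 × L2 × E →L[ℝ] E :=
  heatL - (d • (intL ∘L gradL)).smulRight (κ (profile c))

theorem devL_apply (c d : ℝ) (x : L2 × L2 × E) :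
    devL κ c d x = x.2.2 - (d * intL x.1) • κ (profile c) := rfl

/-- The energy form, in the coordinates `(u_x, u_t, p)`. -/
def energy (μ c d : ℝ) : (L2 × L2 × E) →L[ℝ] (L2 × L2 × E) →L[ℝ] ℝ :=
  (expForm μ).bilinearComp (velL + gradL) (velL + gradL) +
    (expForm (-μ)).bilinearComp (velL - gradL) (velL - gradL) +
    BE.bilinearComp (devL κ c d) (devL κ c d)

theorem energy_apply (μ c d : ℝ) (x y : L2 × L2 × E) : energy κ BE μ c d x y =
    waveForm μ x.1 x.2.1 y.1 y.2.1 + BE (devL κ c d x) (devL κ c d y) := rfl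

variable {ι κ BE} in
theorem IsHeatSpace.isEnergyForm {c m k : ℝ} (h : IsHeatSpace ι κ BE c m k) {μ : ℝ} (hμ : 0 ≤ μ)
    (d : ℝ) : ∃ M : ℝ, IsEnergyForm (energy κ BE μ c d) M := by
  have hE := Real.exp_pos (-μ)
  have hm := h.form.pos
  set D := 2 * (d * ‖κ (profile c)‖) ^ 2 with hD
  have hD0 : 0 ≤ D := by positivity
  set T := (1 + D) * (2 * Real.exp (-μ))⁻¹ + 2 * m⁻¹ with hT
  have hT0 : 0 < T := by positivity
  refine ⟨T⁻¹, fun x y => ?_, by positivity, fun x => ?_⟩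
  · rw [energy_apply, energy_apply, waveForm, waveForm, expForm_comm μ, expForm_comm (-μ),
      h.form.symm]
  rw [energy_apply, inv_mul_le_iff₀ hT0]
  have h1 := waveForm_ge μ hμ x.1 x.2.1
  have h2 := h.form.coercive (devL κ c d x)
  have h3 : ‖x.2.2‖ ^ 2 ≤ 2 * ‖devL κ c d x‖ ^ 2 + D * ‖x.1‖ ^ 2 := by
    have h4 : ‖x.2.2‖ ≤ ‖devL κ c d x‖ + |d| * ‖x.1‖ * ‖κ (profile c)‖ := by
      have e : x.2.2 = devL κ c d x + (d * intL x.1) • κ (profile c) := by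
        rw [devL_apply]; abel
      calc ‖x.2.2‖ ≤ ‖devL κ c d x‖ + ‖(d * intL x.1) • κ (profile c)‖ := by
            conv_lhs => rw [e]
            exact norm_add_le _ _
        _ ≤ _ := by
          rw [norm_smul, Real.norm_eq_abs, abs_mul]
          gcongr
          exact abs_intL_le _
    have h5 : D * ‖x.1‖ ^ 2 = 2 * (|d| * ‖x.1‖ * ‖κ (profile c)‖) ^ 2 := by
      simp only [hD, mul_pow, sq_abs]; ring
    rw [h5]
    have h6 := pow_le_pow_left₀ (norm_nonneg _) h4 2
    nlinarith [sq_nonneg (‖devL κ c d x‖ - |d| * ‖x.1‖ * ‖κ (profile c)‖)]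
  have h7 : ‖x‖ ^ 2 ≤ ‖x.1‖ ^ 2 + ‖x.2.1‖ ^ 2 + ‖x.2.2‖ ^ 2 := by
    have a1 := sq_nonneg ‖x.1‖
    have a2 := sq_nonneg ‖x.2.1‖
    have a3 := sq_nonneg ‖x.2.2‖
    rw [Prod.norm_def, Prod.norm_def]
    rcases max_choice ‖x.1‖ (max ‖x.2.1‖ ‖x.2.2‖) with h | h
    · rw [h]; linarith
    · rcases max_choice ‖x.2.1‖ ‖x.2.2‖ with h' | h' <;> rw [h, h'] <;> linarith
  set V := waveForm μ x.1 x.2.1 x.1 x.2.1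
  set S := BE (devL κ c d x) (devL κ c d x)
  have hV : ‖x.1‖ ^ 2 + ‖x.2.1‖ ^ 2 ≤ (2 * Real.exp (-μ))⁻¹ * V := by
    rw [le_inv_mul_iff₀ (by positivity)]; exact h1
  have hS : ‖devL κ c d x‖ ^ 2 ≤ m⁻¹ * S := by
    rw [le_inv_mul_iff₀ hm]; exact h2
  have hV0 : 0 ≤ V := le_trans (by positivity) h1
  have hS0 : 0 ≤ S := h.form.nonneg _
  have h8 := mul_nonneg hD0 (sq_nonneg ‖x.2.1‖)
  have h9 := mul_le_mul_of_nonneg_left hV (show 0 ≤ 1 + D by positivity)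
  have h10 : 0 ≤ (1 + D) * (2 * Real.exp (-μ))⁻¹ * S := by positivity
  have h11 : 0 ≤ 2 * m⁻¹ * V := by positivity
  calc ‖x‖ ^ 2 ≤ (1 + D) * (‖x.1‖ ^ 2 + ‖x.2.1‖ ^ 2) + 2 * ‖devL κ c d x‖ ^ 2 := by linarith
    _ ≤ (1 + D) * ((2 * Real.exp (-μ))⁻¹ * V) + 2 * (m⁻¹ * S) := by linarith
    _ ≤ T * (V + S) := by rw [hT]; linarith

/-- The value at `0` of the heat component of the inverse generator. -/
def betaL (ε a b c d : ℝ) : L2 × L2 × E →L[ℝ] ℝ :=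
  (c - b * d)⁻¹ • (d • (-a • (intL ∘L gradL) - intL ∘L velL +
    intL ∘L fnL ∘L primL ∘L (0 : L2 × L2 × E →L[ℝ] ℝ).prod velL) - ε • (intL ∘L ι ∘L heatL))

theorem betaL_apply (ε a b c d : ℝ) (z : L2 × L2 × E) : betaL ι ε a b c d z =
    (c - b * d)⁻¹ * (d * (-a * intL z.1 - intL z.2.1 + intL (mkH1 0 z.2.1).fn) -
      ε * intL (ι z.2.2)) := rfl

/-- The value at `0` of the gradient component of the inverse generator. -/
def alphaL (ε a b c d : ℝ) : L2 × L2 × E →L[ℝ] ℝ :=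
  b • betaL ι ε a b c d - a • (intL ∘L gradL) - intL ∘L velL

theorem alphaL_apply (ε a b c d : ℝ) (z : L2 × L2 × E) : alphaL ι ε a b c d z =
    b * betaL ι ε a b c d z - a * intL z.1 - intL z.2.1 := rfl

/-- The inverse of the generator, in the coordinates `(u_x, u_t, p)`. -/
def invGen (ε a b c d : ℝ) : L2 × L2 × E →L[ℝ] L2 × L2 × E :=
  (fnL ∘L primL ∘L (alphaL ι ε a b c d).prod velL).prod
    ((fnL ∘L primL ∘L (0 : L2 × L2 × E →L[ℝ] ℝ).prod gradL).prod
      (κ ∘L primL ∘L (betaL ι ε a b c d).prod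
        (fnL ∘L primL ∘L (c • betaL ι ε a b c d).prod (ε • (ι ∘L heatL)))))

theorem invGen_apply (ε a b c d : ℝ) (z : L2 × L2 × E) : invGen ι κ ε a b c d z =
    ((mkH1 (alphaL ι ε a b c d z) z.2.1).fn, (mkH1 0 z.1).fn,
      κ (mkH1 (betaL ι ε a b c d z) (mkH1 (c * betaL ι ε a b c d z) (ε • ι z.2.2)).fn)) := rfl

theorem mkH1_fn_add (k : ℝ) (f : L2) : (mkH1 k f).fn = k • oneH.fn + (mkH1 0 f).fn := by
  rw [← H1.fn_smul, ← H1.fn_add]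
  congr 1
  refine H1.ext_val ?_ ?_
  · rw [H1.val_add_zero, H1.val_smul_zero, mkH1_val_zero, mkH1_val_zero, oneH, mkH1_val_zero]; ring
  · rw [H1.dx_add, H1.dx_smul, mkH1_dx, mkH1_dx, oneH, mkH1_dx, smul_zero, zero_add]

theorem intL_one : intL oneH.fn = 1 := by
  have : ∫ x in Ioo (0 : ℝ) 1, oneH.fn x = ∫ x in Ioo (0 : ℝ) 1, (1 : ℝ) :=
    integral_congr_ae oneH_fn
  rw [intL_apply, ← setIntegral_Ioo_eq, this]
  simp

theorem intL_mkH1_fn (k : ℝ) (f : L2) : intL (mkH1 k f).fn = k + intL (mkH1 0 f).fn := by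
  rw [mkH1_fn_add k, map_add, map_smul, intL_one, smul_eq_mul, mul_one]

/-- The boundary conditions satisfied by the image of the inverse generator. -/
theorem alphaL_betaL {ε a b c d : ℝ} (hcb : c - b * d ≠ 0) (z : L2 × L2 × E) :
    alphaL ι ε a b c d z + intL z.2.1 = -a * intL z.1 + b * betaL ι ε a b c d z ∧
    c * betaL ι ε a b c d z + ε * intL (ι z.2.2) =
      d * intL (mkH1 (alphaL ι ε a b c d z) z.2.1).fn := by
  have h1 : (c - b * d) * betaL ι ε a b c d z =
      d * (-a * intL z.1 - intL z.2.1 + intL (mkH1 0 z.2.1).fn) - ε * intL (ι z.2.2) := by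
    rw [betaL_apply, mul_inv_cancel_left₀ hcb]
  rw [intL_mkH1_fn, alphaL_apply]
  constructor
  · ring
  · linear_combination h1

variable {ι κ BE} in
theorem IsHeatSpace.invGen_inj {c m k : ℝ} (h : IsHeatSpace ι κ BE c m k) {ε : ℝ} (hε : ε ≠ 0)
    (a b d : ℝ) (z : L2 × L2 × E) (hz : invGen ι κ ε a b c d z = 0) : z = 0 := by
  rw [invGen_apply, Prod.mk_eq_zero, Prod.mk_eq_zero] at hz
  obtain ⟨h1, h2, h3⟩ := hz
  have e1 := H1.dx_eq_zero h1
  have e2 := H1.dx_eq_zero h2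
  rw [mkH1_dx] at e1 e2
  have h4 := congrArg ι h3
  rw [h.comp, map_zero] at h4
  have e3 := H1.dx_eq_zero h4
  rw [mkH1_dx] at e3
  have e4 := H1.dx_eq_zero e3
  rw [mkH1_dx] at e4
  have e5 := h.inj _ ((smul_eq_zero.1 e4).resolve_left hε)
  exact Prod.ext e2 (Prod.ext e1 e5)

variable {ι κ BE} in
/-- The energy form is dissipated at rate `μ / 4` for small `ε`. -/
theorem IsHeatSpace.isDissipativeInverse {a b c d μ m k : ℝ} (h : IsHeatSpace ι κ BE c m k)
    (hμ : 0 < μ) (ha : 0 < a) (hc : 0 < c) (hcb : c - b * d ≠ 0)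
    (haμ : 2 * Real.exp μ ^ 2 * (1 - a) ^ 2 ≤ (1 + a) ^ 2)
    (hF : F μ * (b * d / c) ^ 2 ≤ μ * Real.exp (-μ)) :
    ∃ ε₁ : ℝ, 0 < ε₁ ∧ ∀ ε : ℝ, 0 < ε → ε < ε₁ →
      IsDissipativeInverse (energy κ BE μ c d) (invGen ι κ ε a b c d) (μ / 4) := by
  have hE := Real.exp_pos (-μ)
  have hFpos : 0 < F μ := by
    rw [F]; have := Real.cosh_pos μ; have := Real.sinh_pos_iff.2 hμ; positivity
  set κ₀ := Real.exp (-μ) * (1 + a) ^ 2 / 5 with hκ₀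
  have hκ₀pos : 0 < κ₀ := by positivity
  set r := μ * Real.exp (-μ) * (Real.cosh μ / 2) with hr
  obtain ⟨θ, hθpos, hθr⟩ := exists_young_constant hμ
  rw [← hr] at hθr
  set N := BE (κ (profile c)) (κ (profile c)) with hN
  have hN0 : 0 ≤ N := h.form.nonneg _
  set C := (1 + 1 / θ) * (F μ * b ^ 2) with hC
  have hC0 : 0 ≤ C := by positivity
  set D := d ^ 2 * N / κ₀ with hD
  have hD0 : 0 ≤ D := by positivity
  set T := C + D + μ / 2 with hT
  have hTpos : 0 < T := by positivity
  refine ⟨2 * k / T, div_pos (by have := h.pos; linarith) hTpos, fun ε hε hεlt =>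
    ⟨by positivity, fun z => ?_, h.invGen_inj hε.ne' a b d⟩⟩
  rw [lt_div_iff₀ hTpos] at hεlt
  obtain ⟨bc1, bc2⟩ := alphaL_betaL ι (ε := ε) (a := a) hcb z
  rw [invGen_apply, energy_apply, energy_apply, devL_apply, devL_apply]
  set β := betaL ι ε a b c d z
  set α := alphaL ι ε a b c d z
  set ux := mkH1 α z.2.1 with hux
  set v := mkH1 0 z.1 with hv
  set px := mkH1 (c * β) (ε • ι z.2.2) with hpx
  set p := mkH1 β px.fn with hp
  have hv1 : v.val 1 = intL z.1 := by rw [hv, mkH1_val_one, zero_add]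
  have hwave := waveForm_generator (μ := μ) (a := a) (q := b * β) (ux := ux) (v := v)
    (mkH1_val_zero _ _) (by rw [hux, mkH1_val_one, bc1, hv1])
  have hbdry := boundary_le haμ (v.val 1) (b * β)
  rw [← hκ₀] at hbdry
  have hu1 : intL ux.fn ^ 2 ≤ Real.cosh μ / 2 * waveForm μ ux.fn v.fn ux.fn v.fn :=
    (sq_le_sq' (abs_le.1 (abs_intL_le _)).1 (abs_le.1 (abs_intL_le _)).2).trans
      (norm_sq_le_expForm μ ux.fn v.fn)
  change waveForm μ ux.fn v.fn v.dx ux.dx + BE (κ p - (d * intL ux.fn) • κ (profile c))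
    (z.2.2 - (d * intL z.1) • κ (profile c)) ≤ _
  rw [← hv1]
  set u1 := intL ux.fn
  set v1 := v.val 1
  have hdev : κ p - (d * u1) • κ (profile c) = κ (p - (d * u1) • profile c) := by
    rw [map_sub, map_smul]
  have hprof : (profile c).dx = oneH.fn := rfl
  have hone0 : oneH.val 0 = 1 := mkH1_val_zero _ _
  have hone1 : oneH.val 1 = 1 := by rw [oneH, mkH1_val_one, map_zero, add_zero]
  have hP : (p - (d * u1) • profile c).val 0 = β - d * u1 / c := by
    rw [H1.val_sub_zero, H1.val_smul_zero, hp, mkH1_val_zero, profile, mkH1_val_zero]; ring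
  have hdiss := h.diss (p - (d * u1) • profile c) (px - (d * u1) • oneH) (ε • z.2.2)
    (by rw [H1.fn_sub, H1.fn_smul, H1.dx_sub, H1.dx_smul, hprof, hp, mkH1_dx])
    (by
      rw [hP, H1.val_sub_zero, H1.val_smul_zero, hone0, hpx, mkH1_val_zero]
      field_simp)
    (by
      rw [H1.val_sub_one, H1.val_smul_one, hone1, hpx, mkH1_val_one, map_smul, smul_eq_mul, bc2]
      ring)
    (by
      rw [H1.dx_sub, H1.dx_smul, hpx, mkH1_dx, oneH, mkH1_dx, smul_zero, sub_zero, map_smul])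
  rw [hP, map_smul, smul_eq_mul] at hdiss
  rw [hdev]
  set y := κ (p - (d * u1) • profile c)
  rw [map_sub, map_smul, smul_eq_mul]
  have hcs := h.form.cauchy_schwarz y (κ (profile c))
  rw [← hN] at hcs
  set V := waveForm μ ux.fn v.fn ux.fn v.fn
  set W := waveForm μ ux.fn v.fn v.dx ux.dx
  set S := BE y y
  set G := BE y z.2.2
  set R := BE y (κ (profile c))
  set P := β - d * u1 / c with hPdef
  have hS0 : 0 ≤ S := h.form.nonneg _
  have h1 : F μ * (b * β) ^ 2 ≤ μ / 2 * V + C * P ^ 2 := by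
    have e1 : b * β = b * P + b * d / c * u1 := by rw [hPdef]; ring
    have e2 : (b * P + b * d / c * u1) ^ 2 ≤
        (1 + θ) * ((b * d / c) ^ 2 * u1 ^ 2) + (1 + 1 / θ) * (b ^ 2 * P ^ 2) := by
      have := add_sq_le_young hθpos (b * P) (b * d / c * u1)
      simpa only [mul_pow] using this
    have e4 : F μ * (b * d / c) ^ 2 * u1 ^ 2 ≤ r * V := by
      calc F μ * (b * d / c) ^ 2 * u1 ^ 2 ≤ μ * Real.exp (-μ) * u1 ^ 2 := by gcongr
        _ ≤ μ * Real.exp (-μ) * (Real.cosh μ / 2 * V) := by gcongr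
        _ = r * V := by rw [hr]; ring
    rw [e1]
    calc F μ * (b * P + b * d / c * u1) ^ 2 ≤ F μ * ((1 + θ) * ((b * d / c) ^ 2 * u1 ^ 2) +
          (1 + 1 / θ) * (b ^ 2 * P ^ 2)) := by gcongr
      _ = (1 + θ) * (F μ * (b * d / c) ^ 2 * u1 ^ 2) + C * P ^ 2 := by rw [hC]; ring
      _ ≤ (1 + θ) * (r * V) + C * P ^ 2 := by gcongr
      _ = μ / 2 * V + C * P ^ 2 := by rw [← mul_assoc, hθr]
  have h2 : T * (P ^ 2 + S) ≤ -2 * G := by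
    have e1 := mul_le_mul_of_nonneg_right hεlt.le (show 0 ≤ P ^ 2 + S by positivity)
    have e2 : ε * (T * (P ^ 2 + S)) ≤ ε * (-2 * G) := by linarith
    exact le_of_mul_le_mul_left e2 hε
  have h3 : -2 * (d * v1 * R) ≤ κ₀ * v1 ^ 2 + D * S :=
    neg_two_mul_le_young hκ₀pos hcs
  have h4 : T * (P ^ 2 + S) = C * P ^ 2 + D * S + μ / 2 * S + (D + μ / 2) * P ^ 2 + C * S := by
    rw [hT]; ring
  have h5 : 0 ≤ (D + μ / 2) * P ^ 2 + C * S := by positivity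
  linarith

end Generator

/-! ### The two heat spaces -/

theorem H1.norm_fn_sq_le (w : H1) : ‖w.fn‖ ^ 2 ≤ 2 * w.val 0 ^ 2 + 2 * ‖w.dx‖ ^ 2 := by
  have h := pow_le_pow_left₀ (norm_nonneg _) w.norm_fn_le 2
  rw [← sq_abs (w.val 0)]
  nlinarith [sq_nonneg (|w.val 0| - ‖w.dx‖)]

theorem isHeatSpace_L2 {c : ℝ} (hc : 0 < c) :
    IsHeatSpace (ContinuousLinearMap.id ℝ L2) fnL pairL c 1 (min (c / 3) (1 / 2)) where
  comp _ := rfl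
  inj _ h := h
  form := ⟨pairL_comm, one_pos, fun f => by rw [pairL_self, one_mul]⟩
  pos := by positivity
  diss p px s h1 h2 h3 h4 := by
    have h5 := pairL_by_parts px p
    rw [h1, pairL_self, h2, h3, pairL_comm] at h5
    have hs : s = px.dx := h4
    rw [fnL_apply, hs, pairL_self]
    have h6 := p.norm_fn_sq_le
    have k1 := min_le_left (c / 3) (1 / 2)
    have k2 := min_le_right (c / 3) (1 / 2)
    have k0 : 0 < min (c / 3) (1 / 2) := by positivity
    set k := min (c / 3) (1 / 2)
    have h7 := mul_le_mul_of_nonneg_left h6 k0.le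
    have h8 := mul_le_mul_of_nonneg_right k1 (sq_nonneg (p.val 0))
    have h9 := mul_le_mul_of_nonneg_right k2 (sq_nonneg ‖p.dx‖)
    linarith

/-- The inner product `∫ p_x r_x + c p(0) r(0)` on `H¹(0,1)`. -/
def robinForm (c : ℝ) : H1 →L[ℝ] H1 →L[ℝ] ℝ :=
  pairL.bilinearComp dxL dxL + c • (ContinuousLinearMap.mul ℝ ℝ).bilinearComp val0L val0L

theorem robinForm_apply (c : ℝ) (p r : H1) :
    robinForm c p r = pairL p.dx r.dx + c * (p.val 0 * r.val 0) := by
  rw [← val0L_apply, ← val0L_apply]; rfl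

theorem isHeatSpace_H1 {c : ℝ} (hc : 0 < c) :
    IsHeatSpace fnL (ContinuousLinearMap.id ℝ H1) (robinForm c) c (min (c / 2) (1 / 3))
      ((1 + c) / c ^ 2 + 4)⁻¹ where
  comp _ := rfl
  inj e h := H1.ext' h (H1.dx_eq_zero h)
  form := by
    refine ⟨fun p r => ?_, by positivity, fun p => ?_⟩
    · rw [robinForm_apply, robinForm_apply, pairL_comm, mul_comm (p.val 0)]
    · rw [robinForm_apply, pairL_self, p.norm_sq_eq]
      have h6 := p.norm_fn_sq_le
      have k1 := min_le_left (c / 2) (1 / 3)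
      have k2 := min_le_right (c / 2) (1 / 3)
      have k0 : 0 < min (c / 2) (1 / 3) := by positivity
      set k := min (c / 2) (1 / 3)
      have h7 := mul_le_mul_of_nonneg_left h6 k0.le
      have h8 := mul_le_mul_of_nonneg_right k1 (sq_nonneg (p.val 0))
      have h9 := mul_le_mul_of_nonneg_right k2 (sq_nonneg ‖p.dx‖)
      linarith
  pos := by positivity
  diss p px s h1 h2 h3 h4 := by
    rw [fnL_apply] at h4
    have h5 := pairL_by_parts px s
    rw [h1, h4, pairL_self, h2, h3] at h5
    rw [ContinuousLinearMap.id_apply, robinForm_apply, robinForm_apply, pairL_self]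
    have h6 : px.val 0 ^ 2 ≤ ‖px.dx‖ ^ 2 := by
      have h7 := px.val_one_eq
      have h8 : px.val 0 = -intL px.dx := by linarith
      rw [h8, neg_sq]
      exact sq_le_sq' (abs_le.1 (abs_intL_le _)).1 (abs_le.1 (abs_intL_le _)).2
    have h7 : ‖p.dx‖ ^ 2 ≤ 4 * ‖px.dx‖ ^ 2 := by
      have := px.norm_fn_sq_le
      rw [h1] at this
      linarith
    have h8 : (1 + c) * p.val 0 ^ 2 ≤ (1 + c) / c ^ 2 * ‖px.dx‖ ^ 2 := by
      rw [h2] at h6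
      calc (1 + c) * p.val 0 ^ 2 = (1 + c) / c ^ 2 * (c * p.val 0) ^ 2 := by field_simp
        _ ≤ _ := by gcongr
    have h9 : ((1 + c) / c ^ 2 + 4)⁻¹ *
        (p.val 0 ^ 2 + (‖p.dx‖ ^ 2 + c * (p.val 0 * p.val 0))) ≤ ‖px.dx‖ ^ 2 := by
      rw [inv_mul_le_iff₀ (by positivity)]
      linarith
    linarith

/-! ### Mild solutions -/

theorem norm_le_prodNorm {E : Type*} [NormedAddCommGroup E] (u₀ : H1) (u₁ : L2) (p₀ : E) :
    ‖(u₀.dx, u₁, p₀)‖ ≤ prodNorm u₀ u₁ p₀ := by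
  have h := u₀.norm_sq_eq
  rw [prodNorm, Prod.norm_def, Prod.norm_def]
  refine max_le ?_ (max_le ?_ ?_) <;> refine Real.le_sqrt_of_sq_le ?_ <;>
    nlinarith [sq_nonneg ‖u₀.fn‖, sq_nonneg ‖u₀.dx‖, sq_nonneg ‖u₁‖, sq_nonneg ‖p₀‖]

theorem prodNorm_le_norm {E : Type*} [NormedAddCommGroup E] (x : L2 × L2 × E) :
    prodNorm (mkH1 0 x.1) x.2.1 x.2.2 ≤ 3 * ‖x‖ := by
  have h1 := mkH1_norm_le 0 x.1
  rw [abs_zero, zero_add] at h1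
  have h2 := norm_fst_le x
  have h3 := (norm_fst_le x.2).trans (norm_snd_le x)
  have h4 := (norm_snd_le x.2).trans (norm_snd_le x)
  refine Real.sqrt_le_iff.2 ⟨by positivity, ?_⟩
  have a1 := pow_le_pow_left₀ (norm_nonneg _)
    (h1.trans (mul_le_mul_of_nonneg_left h2 zero_le_two)) 2
  have a2 := pow_le_pow_left₀ (norm_nonneg _) h3 2
  have a3 := pow_le_pow_left₀ (norm_nonneg _) h4 2
  nlinarith [sq_nonneg ‖x‖]

section Transfer

variable {E : Type*} [NormedAddCommGroup E] [InnerProductSpace ℝ E] (ι : E →L[ℝ] L2)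
    (κ : H1 →L[ℝ] E)

/-- The state with coordinates `(u_x, u_t, p)`. -/
def toState : L2 × L2 × E →L[ℝ] State :=
  (primL ∘L (0 : L2 × L2 × E →L[ℝ] ℝ).prod gradL).prod (velL.prod (ι ∘L heatL))

theorem toState_apply (x : L2 × L2 × E) : toState ι x = (mkH1 0 x.1, x.2.1, ι x.2.2) := rfl

/-- The coordinates `(u_x, u_t, p)` of a state. -/
def coords : State →L[ℝ] L2 × L2 × L2 :=
  (dxL ∘L ContinuousLinearMap.fst ℝ H1 (L2 × L2)).prod (ContinuousLinearMap.snd ℝ H1 (L2 × L2))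

theorem coords_apply (Y : State) : coords Y = (Y.1.dx, Y.2.1, Y.2.2) := rfl

theorem isOpValue_invGen (hικ : ∀ w, ι (κ w) = w.fn) {ε a b c d : ℝ} (hε : ε ≠ 0)
    (hcb : c - b * d ≠ 0) (z : L2 × L2 × E) :
    IsOpValue ε a b c d (toState ι (invGen ι κ ε a b c d z)) (toState ι z) := by
  obtain ⟨bc1, bc2⟩ := alphaL_betaL ι (ε := ε) (a := a) hcb z
  rw [invGen_apply, toState_apply, toState_apply]
  refine ⟨mkH1 (alphaL ι ε a b c d z) z.2.1, mkH1 0 z.1,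
    mkH1 (betaL ι ε a b c d z) (mkH1 (c * betaL ι ε a b c d z) (ε • ι z.2.2)).fn,
    mkH1 (c * betaL ι ε a b c d z) (ε • ι z.2.2), rfl, rfl, (hικ _).symm, rfl, mkH1_val_zero _ _,
    mkH1_val_zero _ _, ?_, ?_, ?_, ?_⟩
  · rw [mkH1_val_one, mkH1_val_one, mkH1_val_zero, bc1, zero_add]
  · rw [mkH1_val_zero, mkH1_val_zero]
  · rw [mkH1_val_one, mkH1_val_one, zero_add, map_smul, smul_eq_mul, bc2]
  · simp only [mkH1_dx, smul_smul, inv_mul_cancel₀ hε, one_smul]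

theorem IsOpValue.coords_eq {ε a b c d : ℝ} (hε : ε ≠ 0) (hcb : c - b * d ≠ 0) {P Q : State}
    (h : IsOpValue ε a b c d P Q) : Q.1.val 0 = 0 ∧
      invGen (ContinuousLinearMap.id ℝ L2) fnL ε a b c d (coords Q) = coords P := by
  obtain ⟨ux, v, p, px, h1, h2, h3, h4, h5, h6, h7, h8, h9, rfl⟩ := h
  refine ⟨h6, ?_⟩
  rw [P.1.val_one_eq, h5, zero_add, px.val_one_eq, h8, ← h1, ux.eq_mkH1, intL_mkH1_fn] at h9
  rw [ux.val_one_eq, v.val_one_eq, h6, zero_add] at h7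
  have hβ : betaL (ContinuousLinearMap.id ℝ L2) ε a b c d (coords (v, ux.dx, ε⁻¹ • px.dx)) =
      p.val 0 := by
    rw [betaL_apply, inv_mul_eq_iff_eq_mul₀ hcb]
    simp only [coords_apply, ContinuousLinearMap.id_apply, map_smul, smul_eq_mul]
    rw [mul_inv_cancel_left₀ hε]
    linear_combination -d * h7 - h9
  have hα : alphaL (ContinuousLinearMap.id ℝ L2) ε a b c d (coords (v, ux.dx, ε⁻¹ • px.dx)) =
      ux.val 0 := by
    rw [alphaL_apply, hβ]
    simp only [coords_apply]
    linear_combination -h7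
  rw [invGen_apply, hα, hβ]
  simp only [coords_apply, ContinuousLinearMap.id_apply, smul_smul, mul_inv_cancel₀ hε, one_smul,
    fnL_apply]
  rw [← ux.eq_mkH1, ← h8, ← px.eq_mkH1, h4, ← p.eq_mkH1, ← h6, ← v.eq_mkH1, h1, h2, h3]

/-- Uniqueness of mild solutions of the coupled system. -/
theorem IsMildSolution.eqOn {ε a b c d m ρ : ℝ} (hε : ε ≠ 0) (hcb : c - b * d ≠ 0)
    {B : (L2 × L2 × L2) →L[ℝ] (L2 × L2 × L2) →L[ℝ] ℝ} (hB : IsEnergyForm B m)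
    (hK : IsDissipativeInverse B (invGen (ContinuousLinearMap.id ℝ L2) fnL ε a b c d) ρ)
    {Y₀ : State} {Y Y' : ℝ → State} (h : IsMildSolution ε a b c d Y₀ Y)
    (h' : IsMildSolution ε a b c d Y₀ Y') : EqOn Y' Y (Ici 0) := by
  have hintegrable : ∀ {Y : ℝ → State}, ContinuousOn Y (Ici 0) → ∀ t, 0 ≤ t →
      IntervalIntegrable Y volume 0 t := fun hY t ht =>
    (hY.mono (by rw [uIcc_of_le ht]; exact Icc_subset_Ici_self)).intervalIntegrable
  intro t ht
  have h0 : coords (Y' t - Y t) = 0 := by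
    refine mild_solution_unique hB hK (Y := fun t => coords (Y' t - Y t))
      (coords.continuous.comp_continuousOn (h'.continuousOn.sub h.continuousOn))
      (fun s hs => ?_) ht
    rw [coords.intervalIntegral_comp_comm ((hintegrable h'.continuousOn s hs).sub
      (hintegrable h.continuousOn s hs)), intervalIntegral.integral_sub (hintegrable h'.continuousOn s hs)
      (hintegrable h.continuousOn s hs), map_sub coords (∫ s in (0 : ℝ)..s, Y' s),
      ← ((h'.integrated s hs).coords_eq hε hcb).2, ← ((h.integrated s hs).coords_eq hε hcb).2,
      ← map_sub, ← map_sub, sub_sub_sub_cancel_right]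
  have e1 := ((h'.integrated t ht).coords_eq hε hcb).1
  have e2 := ((h.integrated t ht).coords_eq hε hcb).1
  rw [Prod.fst_sub, H1.val_sub_zero] at e1 e2
  rw [map_sub, sub_eq_zero, coords_apply, coords_apply] at h0
  exact Prod.ext (H1.ext_val (by linarith) (Prod.ext_iff.1 h0).1) (Prod.ext_iff.1 h0).2

/-- The coordinate space with its Hilbert space structure. -/
def hilbertEquiv : (L2 × L2 × E) ≃L[ℝ] WithLp 2 (L2 × WithLp 2 (L2 × E)) :=
  ((ContinuousLinearEquiv.refl ℝ L2).prodCongr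
    (WithLp.prodContinuousLinearEquiv 2 ℝ L2 E).symm).trans
      (WithLp.prodContinuousLinearEquiv 2 ℝ L2 (WithLp 2 (L2 × E))).symm

variable {ι κ} in
/-- Existence and exponential decay of mild solutions, uniformly for small `ε`. -/
theorem IsHeatSpace.exists_decay [CompleteSpace E] {BE : E →L[ℝ] E →L[ℝ] ℝ} {a b c d μ m k : ℝ}
    (h : IsHeatSpace ι κ BE c m k)
    (hμ : 0 < μ) (ha : 0 < a) (hc : 0 < c) (hcb : c - b * d ≠ 0)
    (haμ : 2 * Real.exp μ ^ 2 * (1 - a) ^ 2 ≤ (1 + a) ^ 2)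
    (hF : F μ * (b * d / c) ^ 2 ≤ μ * Real.exp (-μ)) :
    ∃ ε₁ : ℝ, 0 < ε₁ ∧ ∃ C : ℝ, 0 < C ∧ ∀ ε : ℝ, 0 < ε → ε < ε₁ →
      ∀ (u₀ : H1) (u₁ : L2) (p₀ : E), u₀.val 0 = 0 → ∃ Z : ℝ → L2 × L2 × E,
        IsMildSolution ε a b c d (u₀, u₁, ι p₀) (fun t => toState ι (Z t)) ∧
        ∀ t : ℝ, 0 ≤ t → prodNorm (mkH1 0 (Z t).1) (Z t).2.1 (Z t).2.2 ≤
          C * Real.exp (-(μ / 4) * t) * prodNorm u₀ u₁ p₀ := by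
  obtain ⟨M, hB⟩ := h.isEnergyForm hμ.le d
  obtain ⟨ε₁, hε₁, hK⟩ := h.isDissipativeInverse hμ ha hc hcb haμ hF
  obtain ⟨C, hC, hCB⟩ := hB.exists_norm_le
  refine ⟨ε₁, hε₁, 3 * C + 1, by positivity, fun ε hε hεlt u₀ u₁ p₀ hu₀ => ?_⟩
  obtain ⟨Z, hZ, hZ'⟩ := exists_mild_solution hilbertEquiv hB (hK ε hε hεlt) (u₀.dx, u₁, p₀)
  have hinit : toState ι (u₀.dx, u₁, p₀) = (u₀, u₁, ι p₀) := by
    have e : mkH1 0 u₀.dx = u₀ := H1.ext_val (by rw [mkH1_val_zero, hu₀]) rfl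
    rw [toState_apply, e]
  refine ⟨Z, ⟨(toState ι).continuous.comp_continuousOn hZ, fun t ht => ?_⟩, fun t ht => ?_⟩
  · have hi : IntervalIntegrable Z volume 0 t :=
      (hZ.mono (by rw [uIcc_of_le ht]; exact Icc_subset_Ici_self)).intervalIntegrable
    rw [(toState ι).intervalIntegral_comp_comm hi, ← (hZ' t ht).1, ← hinit, ← map_sub]
    exact isOpValue_invGen ι κ h.comp hε.ne' hcb _
  · have h1 : ‖Z t‖ ≤ C * ‖Real.exp (-(μ / 4) * t) • (u₀.dx, u₁, p₀)‖ := by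
      refine hCB _ _ ((hZ' t ht).2.trans (le_of_eq ?_))
      simp only [map_smul, _root_.smul_apply, smul_eq_mul]
      rw [← mul_assoc, ← Real.exp_add]
      congr 2
      ring
    rw [norm_smul, Real.norm_of_nonneg (Real.exp_pos _).le] at h1
    have h2 := norm_le_prodNorm u₀ u₁ p₀
    have h3 := Real.exp_pos (-(μ / 4) * t)
    have h4 : 0 ≤ prodNorm u₀ u₁ p₀ := Real.sqrt_nonneg _
    calc _ ≤ 3 * ‖Z t‖ := prodNorm_le_norm _
      _ ≤ 3 * (C * (Real.exp (-(μ / 4) * t) * prodNorm u₀ u₁ p₀)) := by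
        refine mul_le_mul_of_nonneg_left (h1.trans ?_) (by norm_num)
        gcongr
      _ ≤ _ := by
        have := mul_nonneg h3.le h4
        linarith

end Transfer

/-! ### The parameters -/

theorem eta_pos : 0 < eta := by
  have h : (1 : ℝ) < √3 := by
    rw [Real.lt_sqrt zero_le_one]; norm_num
  rw [eta]
  exact div_pos (by linarith) (by linarith)

theorem ParamConditions.a_pos {a b c d μ : ℝ} (h : ParamConditions a b c d μ) : 0 < a :=
  (inv_pos.2 eta_pos).trans_le h.a_mem.1.1

theorem ParamConditions.c_pos {a b c d μ : ℝ} (h : ParamConditions a b c d μ) : 0 < c :=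
  lt_of_lt_of_le (by have := Real.pi_pos; positivity) h.c_ge

theorem ParamConditions.exp_le {a b c d μ : ℝ} (h : ParamConditions a b c d μ) :
    2 * Real.exp μ ^ 2 * (1 - a) ^ 2 ≤ (1 + a) ^ 2 := by
  have ha := h.a_pos
  have h1 : 0 < |1 - a| := abs_pos.2 (sub_ne_zero.2 fun e => h.a_mem.2 e.symm)
  have h2 : 0 < |1 + a| := abs_pos.2 (by positivity)
  have h3 : Real.exp μ ≤ |1 + a| / (√2 * |1 - a|) :=
    (Real.le_log_iff_exp_le (by positivity)).1 h.mu_le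
  rw [le_div_iff₀ (by positivity)] at h3
  have h4 := pow_le_pow_left₀ (by positivity) h3 2
  rw [mul_pow, mul_pow, Real.sq_sqrt zero_le_two, sq_abs, sq_abs] at h4
  linarith

theorem F_ge (μ : ℝ) (hμ : 0 < μ) : 10 ≤ F μ := by
  have h1 := Real.one_le_cosh μ
  have h2 := Real.sinh_pos_iff.2 hμ
  rw [F]; linarith

theorem ParamConditions.gain_le {a b c d μ : ℝ} (h : ParamConditions a b c d μ)
    (hbd : |b * d| / c ≤ √(μ * Real.exp (-μ) * (F μ)⁻¹)) :
    F μ * (b * d / c) ^ 2 ≤ μ * Real.exp (-μ) := by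
  have hc := h.c_pos
  have hμ := h.mu_pos
  have hF : 0 < F μ := by linarith [F_ge μ hμ]
  have h1 := pow_le_pow_left₀ (by positivity) hbd 2
  rw [Real.sq_sqrt (by positivity), div_pow, sq_abs, ← div_pow, ← div_eq_mul_inv,
    le_div_iff₀ hF] at h1
  linarith

theorem ParamConditions.sub_ne_zero {a b c d μ : ℝ} (h : ParamConditions a b c d μ)
    (hbd : |b * d| / c ≤ √(μ * Real.exp (-μ) * (F μ)⁻¹)) : c - b * d ≠ 0 := by
  intro h0
  have h1 := h.gain_le hbd
  have h2 : b * d / c = 1 := by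
    rw [div_eq_one_iff_eq h.c_pos.ne']; linarith
  rw [h2] at h1
  have h3 : μ * Real.exp (-μ) ≤ 1 := by
    have := Real.add_one_le_exp μ
    rw [Real.exp_neg, ← div_eq_mul_inv, div_le_one (Real.exp_pos _)]
    linarith
  linarith [F_ge μ h.mu_pos]

end WaveHeat

end

theorem theorem2 (a b c d μ : ℝ) (h : WaveHeat.ParamConditions a b c d μ)
    (hbd : |b * d| / c ≤ √(μ * Real.exp (-μ) * (WaveHeat.F μ)⁻¹)) :
    (Real.pi ^ 2 / 4 + WaveHeat.F μ * b ^ 2 ≤ c →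
      ∃ ε₁ : ℝ, 0 < ε₁ ∧ ∃ C₁ : ℝ, 0 < C₁ ∧ ∀ ε : ℝ, 0 < ε → ε < ε₁ →
        ∀ (u₀ : WaveHeat.H1) (u₁ p₀ : WaveHeat.L2), u₀.val 0 = 0 →
          ∃ Y : ℝ → WaveHeat.State,
            WaveHeat.IsTheMildSolution ε a b c d (u₀, u₁, p₀) Y ∧
            ∀ t : ℝ, 0 ≤ t →
              WaveHeat.prodNorm (Y t).1 (Y t).2.1 (Y t).2.2 ≤
                C₁ * Real.exp (-(μ / 4) * t) * WaveHeat.prodNorm u₀ u₁ p₀) ∧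
    (3 * WaveHeat.F μ * b ^ 2 ≤ c →
      ∃ ε₂ : ℝ, 0 < ε₂ ∧ ∃ C₂ : ℝ, 0 < C₂ ∧ ∀ ε : ℝ, 0 < ε → ε < ε₂ →
        ∀ (u₀ : WaveHeat.H1) (u₁ : WaveHeat.L2) (p₀ : WaveHeat.H1), u₀.val 0 = 0 →
          ∃ Y : ℝ → WaveHeat.State,
            WaveHeat.IsTheMildSolution ε a b c d (u₀, u₁, p₀.fn) Y ∧
            ∀ t : ℝ, 0 ≤ t → ∃ P : WaveHeat.H1, P.fn = (Y t).2.2 ∧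
              WaveHeat.prodNorm (Y t).1 (Y t).2.1 P ≤
                C₂ * Real.exp (-(μ / 4) * t) * WaveHeat.prodNorm u₀ u₁ p₀) := by
  have hcb := h.sub_ne_zero hbd
  have hF := h.gain_le hbd
  obtain ⟨M, hB⟩ := (WaveHeat.isHeatSpace_L2 h.c_pos).isEnergyForm h.mu_pos.le d
  obtain ⟨ε₀, hε₀, hK⟩ := (WaveHeat.isHeatSpace_L2 h.c_pos).isDissipativeInverse h.mu_pos h.a_pos
    h.c_pos hcb h.exp_le hF
  refine ⟨fun _ => ?_, fun _ => ?_⟩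
  · obtain ⟨ε₁, hε₁, C, hC, H⟩ := (WaveHeat.isHeatSpace_L2 h.c_pos).exists_decay h.mu_pos h.a_pos
      h.c_pos hcb h.exp_le hF
    refine ⟨min ε₁ ε₀, lt_min hε₁ hε₀, C, hC, fun ε hε hlt u₀ u₁ p₀ hu₀ => ?_⟩
    obtain ⟨Z, hZ, hZ'⟩ := H ε hε (hlt.trans_le (min_le_left _ _)) u₀ u₁ p₀ hu₀
    exact ⟨_, ⟨hZ, fun Y' hY' => hZ.eqOn hε.ne' hcb hB
      (hK ε hε (hlt.trans_le (min_le_right _ _))) hY'⟩, hZ'⟩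
  · obtain ⟨ε₁, hε₁, C, hC, H⟩ := (WaveHeat.isHeatSpace_H1 h.c_pos).exists_decay h.mu_pos h.a_pos
      h.c_pos hcb h.exp_le hF
    refine ⟨min ε₁ ε₀, lt_min hε₁ hε₀, C, hC, fun ε hε hlt u₀ u₁ p₀ hu₀ => ?_⟩
    obtain ⟨Z, hZ, hZ'⟩ := H ε hε (hlt.trans_le (min_le_left _ _)) u₀ u₁ p₀ hu₀
    exact ⟨_, ⟨hZ, fun Y' hY' => hZ.eqOn hε.ne' hcb hB
      (hK ε hε (hlt.trans_le (min_le_right _ _))) hY'⟩, fun t ht => ⟨(Z t).2.2, rfl, hZ' t ht⟩⟩
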